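/- Let $H$ be a separable real Hilbert space, $0<T<\infty$, $L^2_H=L^2([0,T];H)$, and let $A^2_H$ be the space of absolutely continuous arcs $u:[0,T]\to H$ with $\dot u\in L^2_H$. A convex Lagrangian is a convex, lower semicontinuous function $f:H\times H\to\mathbb R\cup\{+\infty\}$, not identically $+\infty$; put $f^*(q,y)=\sup_{x,p\in H}\{\langle q,x\rangle+\langle y,p\rangle-f(x,p)\}$, $\mathrm{Dom}(f)=\{f<+\infty\}$, and let $\partial f$ be its subdifferential in both variables. Let $L:[0,T]\times H\times H\to\mathbb R\cup\{+\infty\}$ be an anti-self dual Lagrangian: $L$ is measurable for the $\sigma$-field generated by the products of Lebesgue subsets of $[0,T]$ and Borel subsets of $H\times H$, and for every $t\in[0,T]$ the function $L(t,\cdot,\cdot)$ is a convex Lagrangian with $L(t,\cdot,\cdot)^*(p,x)=L(t,-x,-p)$ for all $x,p\in H$. Assume that for some $C>0$ $$\int_0^T L(t,x(t),0)\,dt\le C\,(1+\|x\|^2_{L^2_H})\qquad\text{for all }x\in L^2_H .$$ For a convex Lagrangian $\ell$ on $H\times H$ put $I_{\ell,L}(u)=\int_0^T L(t,u(t),\dot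 u(t))\,dt+\ell(u(0),u(T))$ for $u\in A^2_H$. (1) Let $\ell$ be a self-dual boundary Lagrangian on $H\times H$, that is, a convex Lagrangian with $\ell^*(-h_1,h_2)=\ell(h_1,h_2)$ for all $h_1,h_2\in H$, and assume that $\ell(\cdot,0)$ is bounded above on a neighbourhood of $0$ in $H$. Then there is $v\in A^2_H$ such that $(v(t),\dot v(t))\in\mathrm{Dom}(L(t,\cdot,\cdot))$ for almost every $t\in[0,T]$ and $I_{\ell,L}(v)=\inf_{u\in A^2_H}I_{\ell,L}(u)=0$. (2) For every $v_0\in H$ the functional $$I(u)=\int_0^T L(t,u(t),\dot u(t))\,dt+\tfrac12\|u(0)\|^2-2\langle v_0,u(0)\rangle+\|v_0\|^2+\tfrac12\|u(T)\|^2$$ has minimum $0$ on $A^2_H$. It is attained at a unique $v\in A^2_H$, and this $v$ satisfies: * $v(0)=v_0$, and $(v(t),\dot v(t))\in \mathrm{Dom}(L(t,\cdot,\cdot))$ for a.e. $t\in[0,T]$; * $\frac{d}{dt}\partial_pL(t,v(t),\dot v(t))=\partial_xL(t,v(t),\dot v(t))$, in the sense that there is $\xi\in A^2_H$ with $\xi(t)\in\partial_pL(t,v(t),\dot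 v(t))$ and $\dot\xi(t)\in\partial_xL(t,v(t),\dot v(t))$ for a.e. $t\in[0,T]$, where $\partial_x,\partial_p$ are the partial subdifferentials; * $(-\dot v(t),-v(t))\in\partial L(t,v(t),\dot v(t))$ for a.e. $t\in[0,T]$; * $s\mapsto L(s,v(s),\dot v(s))$ is integrable on $[0,T]$, and $\|v(t)\|^2=\|v_0\|^2-2\int_0^tL(s,v(s),\dot v(s))\,ds$ for every $t\in[0,T]$; * if $L$ does not depend on $t$ and $v\in C^1([0,T],H)$, then $\|\dot v(t)\|\le\|\dot v(0)\|$ for all $t\in[0,T]$. -/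

import Mathlib

open MeasureTheory Set

noncomputable section

namespace ASD

/-- The class of convex Lagrangians: functions `f : H × H → ℝ ∪ {+∞}` (written in curried form)
that are convex, lower semicontinuous (jointly in both variables) and not identically `+∞`. -/
structure IsConvexLagrangian {H : Type*} [NormedAddCommGroup H] [InnerProductSpace ℝ H]
    (f : H → H → EReal) : Prop where
  ne_bot : ∀ x p, f x p ≠ ⊥
  proper : ∃ x p, f x p ≠ ⊤
  lsc : LowerSemicontinuous fun z : H × H => f z.1 z.2
  convex_epigraph : Convex ℝ {z : (H × H) × ℝ | f z.1.1 z.1.2 ≤ (z.2 : EReal)}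

/-- The Legendre-Fenchel dual in both variables,
`f* (q, y) = sup_{x, p} ⟨q, x⟩ + ⟨y, p⟩ - f (x, p)`. -/
def legendre {H : Type*} [NormedAddCommGroup H] [InnerProductSpace ℝ H]
    (f : H → H → EReal) (q y : H) : EReal :=
  ⨆ (x : H) (p : H), ((inner ℝ q x + inner ℝ y p : ℝ) : EReal) - f x p

/-- The σ-algebra of Lebesgue measurable subsets of `ℝ`. -/
abbrev lebesgueSets : MeasurableSpace ℝ :=
  inferInstanceAs (MeasurableSpace (NullMeasurableSpace ℝ (volume : Measure ℝ)))

/-- `L` is a (time-dependent) anti-self dual Lagrangian on `[0,T] × H × H`: it is measurable for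
the σ-algebra generated by products of Lebesgue subsets of `[0,T]` and Borel subsets of `H × H`,
and for each `t ∈ [0,T]`, `L t` is a convex Lagrangian with `(L t)* (p, x) = L t (-x, -p)`.
The values `L t` for `t ∉ [0,T]` are irrelevant. -/
structure IsASDLagrangian {H : Type*} [NormedAddCommGroup H] [InnerProductSpace ℝ H]
    (T : ℝ) (L : ℝ → H → H → EReal) : Prop where
  measurable :
    @Measurable (Icc (0 : ℝ) T × (H × H)) EReal
      (@Prod.instMeasurableSpace _ _ (lebesgueSets.comap Subtype.val) (borel (H × H))) _
      (fun z => L z.1 z.2.1 z.2.2)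
  lagrangian : ∀ t ∈ Icc (0 : ℝ) T, IsConvexLagrangian (L t)
  antiselfdual : ∀ t ∈ Icc (0 : ℝ) T, ∀ p x : H, legendre (L t) p x = L t (-x) (-p)

/-- `ℓ` is a self-dual boundary Lagrangian on `H × H`: a convex Lagrangian with
`ℓ* (-h₁, h₂) = ℓ (h₁, h₂)`. -/
structure IsSelfDualBoundary {H : Type*} [NormedAddCommGroup H] [InnerProductSpace ℝ H]
    (l : H → H → EReal) : Prop where
  lagrangian : IsConvexLagrangian l
  selfdual : ∀ h₁ h₂ : H, legendre l (-h₁) h₂ = l h₁ h₂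

/-- The boundary Lagrangian encoding the initial condition `u(0) = v₀`:
`ℓ (r, s) = ‖r‖² / 2 - 2 ⟨v₀, r⟩ + ‖v₀‖² + ‖s‖² / 2`. -/
def initialBoundary {H : Type*} [NormedAddCommGroup H] [InnerProductSpace ℝ H]
    (v₀ : H) (r s : H) : EReal :=
  ((1 / 2 * ‖r‖ ^ 2 - 2 * inner ℝ v₀ r + ‖v₀‖ ^ 2 + 1 / 2 * ‖s‖ ^ 2 : ℝ) : EReal)

/-- The integral `∫₀ᵀ f⁺ - ∫₀ᵀ f⁻` of an extended-real-valued function. (It is only used for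
functions whose negative part has a finite integral, so that no `∞ - ∞` occurs.) -/
def extIntegral (T : ℝ) (f : ℝ → EReal) : EReal :=
  ((∫⁻ t in Icc (0 : ℝ) T, (f t).toENNReal : ENNReal) : EReal)
    - ((∫⁻ t in Icc (0 : ℝ) T, (-f t).toENNReal : ENNReal) : EReal)

/-- `u ∈ A²_H`: `u` is an absolutely continuous arc `[0,T] → H` with `u̇ ∈ L²_H`. Absolute
continuity is expressed by the fundamental theorem of calculus: `u` is the (Bochner) integral of
its almost everywhere derivative. Only the values of `u` on `[0,T]` matter. -/
structure MemA2 {H : Type*} [NormedAddCommGroup H] [InnerProductSpace ℝ H] [CompleteSpace H]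
    (T : ℝ) (u : ℝ → H) : Prop where
  memLp_deriv : MemLp (deriv u) 2 (volume.restrict (Icc (0 : ℝ) T))
  eq_integral : ∀ t ∈ Icc (0 : ℝ) T, u t = u 0 + ∫ s in (0 : ℝ)..t, deriv u s

/-- The functional `I_{ℓ,L} (u) = ∫₀ᵀ L (t, u(t), u̇(t)) dt + ℓ (u(0), u(T))`. -/
def action {H : Type*} [NormedAddCommGroup H] [InnerProductSpace ℝ H]
    (T : ℝ) (L : ℝ → H → H → EReal) (l : H → H → EReal) (u : ℝ → H) : EReal :=
  extIntegral T (fun t => L t (u t) (deriv u t)) + l (u 0) (u T)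

/-- The subdifferential of a function `g : H → ℝ ∪ {+∞}` at `x`. -/
def subdiff {H : Type*} [NormedAddCommGroup H] [InnerProductSpace ℝ H]
    (g : H → EReal) (x : H) : Set H :=
  {q | g x ≠ ⊤ ∧ ∀ x', g x + ((inner ℝ q (x' - x) : ℝ) : EReal) ≤ g x'}

/-- The subdifferential of a function `f : H × H → ℝ ∪ {+∞}`, jointly in both variables, at
`(x, p)`. -/
def subdiff₂ {H : Type*} [NormedAddCommGroup H] [InnerProductSpace ℝ H]
    (f : H → H → EReal) (x p : H) : Set (H × H) :=
  {z | f x p ≠ ⊤ ∧ ∀ x' p',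
    f x p + ((inner ℝ z.1 (x' - x) + inner ℝ z.2 (p' - p) : ℝ) : EReal) ≤ f x' p'}

/-- `v` satisfies the Euler-Lagrange equation `d/dt ∂ₚL (t, v, v̇) = ∂ₓL (t, v, v̇)` on `[0,T]`, in
terms of the partial subdifferentials: for some arc `ξ ∈ A²_H`, for almost every `t`,
`ξ(t) ∈ ∂ₚL (t, v(t), v̇(t))` and `ξ̇(t) ∈ ∂ₓL (t, v(t), v̇(t))`. -/
def EulerLagrange {H : Type*} [NormedAddCommGroup H] [InnerProductSpace ℝ H] [CompleteSpace H]
    (T : ℝ) (L : ℝ → H → H → EReal) (v : ℝ → H) : Prop :=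
  ∃ ξ : ℝ → H, MemA2 T ξ ∧ ∀ᵐ t ∂(volume.restrict (Icc (0 : ℝ) T)),
    ξ t ∈ subdiff (fun p => L t (v t) p) (deriv v t) ∧
    deriv ξ t ∈ subdiff (fun x => L t x (deriv v t)) (v t)

end ASD

end

noncomputable section

namespace ASD

open Filter Topology

/-! Anti-self duality and Fenchel's inequality give `L (t, x, p) ≥ -⟨x, p⟩`, and self-duality gives
`ℓ (e, f) ≥ (‖f‖² - ‖e‖²) / 2`. Along an arc `u` the integral of `⟨u, u̇⟩` is `(‖u(T)‖² - ‖u(0)‖²) /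
2`, so the two bounds cancel and the action is nonnegative (`action_nonneg`).

The value `0` is attained by duality. Let `V (y, c)` be the infimum over arcs `u` of `∫ L (t, u + y,
u̇) + ℓ (u(0) + c, u(T))`. It is convex, `V (0, 0) ≥ 0`, and the zero arc bounds it above near the
origin, using the growth of `L (t, ·, 0)` and the bound on `ℓ (·, 0)`. Hahn-Banach
(`exists_linear_minorant`) yields `(p, b)` with `⟨p, y⟩ + ⟨b, c⟩ ≤ V (y, c)`. Let `v` be the arc
with `v(0) = b` and `v̇ = p`. After integration by parts, `x = u + y`, `w = u̇`, `e = u(0) + c` and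
`f = u(T)` become independent variables (`legendre_boundary_le`). The suprema over them give `∫ L*
(t, v̇, v) + ℓ* (b, -v(T)) ≤ 0`, and the two dualities turn the left side into the action of `-v`.

Taking the supremum inside the integral is the analytic core (`exists_integrable_conjugate`).
Maximizers of the conjugate need not exist, so they are regularized by `ε ‖·‖² / 2`. The regularized
maximizer is unique and, by anti-self duality, characterized by values of `L` alone; its graph is
therefore Borel and it is measurable in `t` (`exists_measurable_isProx`). Truncation and Fatou's
lemma finish.

For the initial-value boundary term, zero action is the vanishing of `∫ (L + ⟨u, u̇⟩) + ‖u(0) -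
v₀‖²`, a sum of nonnegative terms. This yields the initial condition and equality in Fenchel's
inequality a.e., hence the differential inclusion and the energy identity. Extremal points satisfy
`⟨x - x', p - p'⟩ ≤ 0` (`inner_sub_sub_nonpos`), so distances between trajectories do not increase;
uniqueness and the decay of `‖v̇‖` follow. -/

lemma intervalIntegrable_of_memLp {E : Type*} [NormedAddCommGroup E] {T : ℝ} (hT : 0 ≤ T)
    {w : ℝ → E} (hw : MemLp w 2 (volume.restrict (Icc (0 : ℝ) T))) : IntervalIntegrable w volume 0 T := by
  rw [intervalIntegrable_iff_integrableOn_Icc_of_le hT]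
  exact hw.integrable (by norm_num)

lemma memLp_of_continuousOn {E : Type*} [NormedAddCommGroup E] {T : ℝ} {u : ℝ → E}
    (hu : ContinuousOn u (Icc 0 T)) :
    MemLp u 2 (volume.restrict (Icc (0 : ℝ) T)) := by
  obtain ⟨C, hC⟩ := isCompact_Icc.exists_bound_of_continuousOn hu
  refine MemLp.of_bound (hu.aestronglyMeasurable_of_isCompact isCompact_Icc measurableSet_Icc) C ?_
  filter_upwards [ae_restrict_mem measurableSet_Icc] with t ht using hC t ht

/-! ### Primitives of integrable functions and integration by parts in `H` -/

section Primitive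

variable {H : Type*} [NormedAddCommGroup H] [InnerProductSpace ℝ H]

/-- A primitive of an integrable function, with prescribed value at `0`. -/
def primitive (a : H) (w : ℝ → H) (t : ℝ) : H := a + ∫ s in (0 : ℝ)..t, w s

@[simp] lemma primitive_zero (a : H) (w : ℝ → H) : primitive a w 0 = a := by simp [primitive]

lemma primitive_sub {T : ℝ} (hT : 0 ≤ T) (a : H) {w : ℝ → H}
    (hw : IntervalIntegrable w volume 0 T) {s t : ℝ} (hs : s ∈ Icc 0 T) (ht : t ∈ Icc 0 T) :
    primitive a w t - primitive a w s = ∫ r in s..t, w r := by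
  have h1 : IntervalIntegrable w volume 0 s := hw.mono_set (by
    rw [uIcc_of_le hs.1, uIcc_of_le hT]; exact Icc_subset_Icc_right hs.2)
  have h2 : IntervalIntegrable w volume 0 t := hw.mono_set (by
    rw [uIcc_of_le ht.1, uIcc_of_le hT]; exact Icc_subset_Icc_right ht.2)
  simp [primitive, intervalIntegral.integral_interval_sub_left h2 h1]

lemma continuousOn_primitive {T : ℝ} (hT : 0 ≤ T) (a : H) {w : ℝ → H}
    (hw : IntervalIntegrable w volume 0 T) : ContinuousOn (primitive a w) (Icc 0 T) := by
  have := intervalIntegral.continuousOn_primitive_interval' hw left_mem_uIcc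
  rw [uIcc_of_le hT] at this
  exact continuousOn_const.add this

/-- Increments of the norm are dominated by increments of the primitive of `‖w‖`. Passing to the
norm reduces the energy identity to the fundamental theorem for scalar functions. -/
lemma absolutelyContinuousOnInterval_norm_primitive {T : ℝ} (hT : 0 ≤ T) (a : H) {w : ℝ → H}
    (hw : IntervalIntegrable w volume 0 T) :
    AbsolutelyContinuousOnInterval (fun t => ‖primitive a w t‖) 0 T := by
  have hW := hw.norm.absolutelyContinuousOnInterval_intervalIntegral (c := 0) left_mem_uIcc
  rw [absolutelyContinuousOnInterval_iff] at hW ⊢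
  intro ε hε
  obtain ⟨δ, hδ, h⟩ := hW ε hε
  refine ⟨δ, hδ, fun E hE hE' => lt_of_le_of_lt (Finset.sum_le_sum fun i hi => ?_) (h E hE hE')⟩
  obtain ⟨h1, h2⟩ := hE.1 i hi
  rw [uIcc_of_le hT] at h1 h2
  have hi1 : IntervalIntegrable (fun x => ‖w x‖) volume 0 (E.2 i).1 := hw.norm.mono_set (by
    rw [uIcc_of_le h1.1, uIcc_of_le hT]; exact Icc_subset_Icc_right h1.2)
  have hi2 : IntervalIntegrable (fun x => ‖w x‖) volume 0 (E.2 i).2 := hw.norm.mono_set (by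
    rw [uIcc_of_le h2.1, uIcc_of_le hT]; exact Icc_subset_Icc_right h2.2)
  calc dist ‖primitive a w (E.2 i).1‖ ‖primitive a w (E.2 i).2‖
      ≤ ‖primitive a w (E.2 i).1 - primitive a w (E.2 i).2‖ := by
        rw [Real.dist_eq]; exact abs_norm_sub_norm_le _ _
    _ = ‖∫ r in (E.2 i).2..(E.2 i).1, w r‖ := by rw [primitive_sub hT a hw h2 h1]
    _ ≤ |∫ r in (E.2 i).2..(E.2 i).1, ‖w r‖| :=
        intervalIntegral.norm_integral_le_abs_integral_norm
    _ = _ := by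
        rw [Real.dist_eq, intervalIntegral.integral_interval_sub_left hi1 hi2]

lemma intervalIntegrable_inner_continuousOn {T : ℝ} (hT : 0 ≤ T) {u w : ℝ → H}
    (hu : ContinuousOn u (Icc 0 T)) (hw : IntervalIntegrable w volume 0 T) :
    IntervalIntegrable (fun t => inner ℝ (u t) (w t)) volume 0 T := by
  rw [intervalIntegrable_iff_integrableOn_Icc_of_le hT] at hw ⊢
  obtain ⟨C, hC⟩ := isCompact_Icc.exists_bound_of_continuousOn hu
  refine Integrable.mono' (g := fun t => C * ‖w t‖) (hw.norm.const_mul C) ?_ ?_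
  · exact (hu.aestronglyMeasurable_of_isCompact isCompact_Icc measurableSet_Icc).inner hw.1
  · filter_upwards [ae_restrict_mem measurableSet_Icc] with t ht
    exact (norm_inner_le_norm _ _).trans (by gcongr; exact hC t ht)

lemma primitive_add {T : ℝ} (hT : 0 ≤ T) (a b : H) {w p : ℝ → H}
    (hw : IntervalIntegrable w volume 0 T) (hp : IntervalIntegrable p volume 0 T)
    {t : ℝ} (ht : t ∈ Icc 0 T) :
    primitive (a + b) (w + p) t = primitive a w t + primitive b p t := by
  have hsub : uIcc 0 t ⊆ uIcc 0 T := by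
    rw [uIcc_of_le ht.1, uIcc_of_le hT]; exact Icc_subset_Icc_right ht.2
  simp only [primitive, Pi.add_apply]
  rw [intervalIntegral.integral_add (hw.mono_set hsub) (hp.mono_set hsub)]
  abel

lemma primitive_neg (a : H) (w : ℝ → H) (t : ℝ) :
    primitive (-a) (-w) t = -primitive a w t := by
  simp only [primitive, Pi.neg_apply, intervalIntegral.integral_neg]
  abel

lemma primitive_smul (c : ℝ) (a : H) (w : ℝ → H) (t : ℝ) :
    primitive (c • a) (c • w) t = c • primitive a w t := by
  simp only [primitive, Pi.smul_apply, intervalIntegral.integral_smul, smul_add]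

variable [CompleteSpace H]

lemma hasDerivAt_primitive_ae {T : ℝ} (a : H) {w : ℝ → H}
    (hw : IntervalIntegrable w volume 0 T) :
    ∀ᵐ t, t ∈ uIcc 0 T → HasDerivAt (primitive a w) (w t) t := by
  filter_upwards [hw.ae_hasDerivAt_integral] with t ht h
  exact (ht h 0 left_mem_uIcc).const_add a

lemma integral_inner_primitive_self {T : ℝ} (hT : 0 ≤ T) (a : H) {w : ℝ → H}
    (hw : IntervalIntegrable w volume 0 T) :
    ∫ t in (0 : ℝ)..T, inner ℝ (primitive a w t) (w t)
      = (‖primitive a w T‖ ^ 2 - ‖a‖ ^ 2) / 2 := by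
  have hac := absolutelyContinuousOnInterval_norm_primitive hT a hw
  have h := (hac.fun_mul hac).integral_deriv_eq_sub
  have h2 : ∫ t in (0 : ℝ)..T, deriv (fun t => ‖primitive a w t‖ * ‖primitive a w t‖) t
      = ∫ t in (0 : ℝ)..T, 2 * inner ℝ (primitive a w t) (w t) := by
    apply intervalIntegral.integral_congr_ae
    filter_upwards [hasDerivAt_primitive_ae a hw] with t ht ht'
    have := (ht (uIoc_subset_uIcc ht')).norm_sq
    have h3 : (fun t => ‖primitive a w t‖ * ‖primitive a w t‖)
        = fun t => ‖primitive a w t‖ ^ 2 := by ext; ring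
    rw [h3, this.deriv]
  rw [h2, intervalIntegral.integral_const_mul] at h
  rw [primitive_zero] at h
  linarith

/-- Integration by parts for two primitives. -/
lemma integral_inner_primitive_add {T : ℝ} (hT : 0 ≤ T) (a b : H) {w p : ℝ → H}
    (hw : IntervalIntegrable w volume 0 T) (hp : IntervalIntegrable p volume 0 T) :
    ∫ t in (0 : ℝ)..T, (inner ℝ (p t) (primitive a w t) + inner ℝ (primitive b p t) (w t))
      = inner ℝ (primitive b p T) (primitive a w T) - inner ℝ b a := by
  have hTT : T ∈ Icc 0 T := ⟨hT, le_rfl⟩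
  -- Polarization: the energy identity for the sum and for the difference of the two primitives.
  have e1 := integral_inner_primitive_self hT (a + b) (w := w + p) (hw.add hp)
  have e2 := integral_inner_primitive_self hT (a + -b) (w := w + -p) (hw.add hp.neg)
  have hc := continuousOn_primitive hT a hw
  have hd := continuousOn_primitive hT b hp
  have c1 : ∫ t in (0 : ℝ)..T, inner ℝ (primitive (a + b) (w + p) t) ((w + p) t)
      = ∫ t in (0 : ℝ)..T, inner ℝ (primitive a w t + primitive b p t) (w t + p t) := by
    apply intervalIntegral.integral_congr
    intro t ht
    rw [uIcc_of_le hT] at ht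
    simp only [primitive_add hT a b hw hp ht, Pi.add_apply]
  have c2 : ∫ t in (0 : ℝ)..T, inner ℝ (primitive (a + -b) (w + -p) t) ((w + -p) t)
      = ∫ t in (0 : ℝ)..T, inner ℝ (primitive a w t - primitive b p t) (w t - p t) := by
    apply intervalIntegral.integral_congr
    intro t ht
    rw [uIcc_of_le hT] at ht
    simp only [primitive_add hT a (-b) hw hp.neg ht, primitive_neg, Pi.add_apply, Pi.neg_apply,
      sub_eq_add_neg]
  rw [c1, primitive_add hT a b hw hp hTT] at e1
  rw [c2, primitive_add hT a (-b) hw hp.neg hTT, primitive_neg, ← sub_eq_add_neg,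
    ← sub_eq_add_neg] at e2
  have i1 := intervalIntegrable_inner_continuousOn hT (hc.add hd) (hw.add hp)
  have i2 := intervalIntegrable_inner_continuousOn hT (hc.sub hd) (hw.sub hp)
  have e3 := intervalIntegral.integral_sub i1 i2
  have e4 : ∫ t in (0 : ℝ)..T, (inner ℝ (primitive a w t + primitive b p t) (w t + p t) -
      inner ℝ (primitive a w t - primitive b p t) (w t - p t))
      = ∫ t in (0 : ℝ)..T,
        2 * (inner ℝ (p t) (primitive a w t) + inner ℝ (primitive b p t) (w t)) := by
    congr 1; ext t
    simp only [inner_add_left, inner_add_right, inner_sub_left, inner_sub_right,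
      real_inner_comm (p t)]
    ring
  have e5 := e4.symm.trans e3
  simp only [Pi.add_apply, Pi.sub_apply] at e5
  rw [intervalIntegral.integral_const_mul, e1, e2] at e5
  rw [norm_add_sq_real, norm_sub_sq_real, norm_add_sq_real, norm_sub_sq_real,
    real_inner_comm (primitive b p T), real_inner_comm b] at e5
  linarith

lemma MemA2.intervalIntegrable {T : ℝ} (hT : 0 ≤ T) {u : ℝ → H} (hu : MemA2 T u) :
    IntervalIntegrable (deriv u) volume 0 T := intervalIntegrable_of_memLp hT hu.memLp_deriv

lemma MemA2.eq_primitive {T : ℝ} {u : ℝ → H} (hu : MemA2 T u) {t : ℝ} (ht : t ∈ Icc 0 T) :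
    u t = primitive (u 0) (deriv u) t := hu.eq_integral t ht

lemma MemA2.continuousOn {T : ℝ} (hT : 0 ≤ T) {u : ℝ → H} (hu : MemA2 T u) :
    ContinuousOn u (Icc 0 T) :=
  (continuousOn_primitive hT (u 0) (hu.intervalIntegrable hT)).congr fun _ ht => hu.eq_primitive ht

lemma MemA2.mono {T S : ℝ} (hST : S ≤ T) {u : ℝ → H} (hu : MemA2 T u) : MemA2 S u where
  memLp_deriv := hu.memLp_deriv.mono_measure
    (Measure.restrict_mono (Icc_subset_Icc_right hST) le_rfl)
  eq_integral t ht := hu.eq_integral t ⟨ht.1, ht.2.trans hST⟩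

lemma MemA2.integral_inner_deriv {T : ℝ} (hT : 0 ≤ T) {u : ℝ → H} (hu : MemA2 T u) :
    ∫ t in (0 : ℝ)..T, inner ℝ (u t) (deriv u t) = (‖u T‖ ^ 2 - ‖u 0‖ ^ 2) / 2 := by
  rw [hu.eq_primitive ⟨hT, le_rfl⟩,
    ← integral_inner_primitive_self hT (u 0) (hu.intervalIntegrable hT)]
  apply intervalIntegral.integral_congr
  intro t ht
  rw [uIcc_of_le hT] at ht
  simp only [← hu.eq_primitive ht]

lemma MemA2.integrable_inner_deriv {T : ℝ} (hT : 0 ≤ T) {u : ℝ → H} (hu : MemA2 T u) :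
    Integrable (fun t => inner ℝ (u t) (deriv u t)) (volume.restrict (Icc (0 : ℝ) T)) := by
  have := intervalIntegrable_inner_continuousOn hT (hu.continuousOn hT) (hu.intervalIntegrable hT)
  rwa [intervalIntegrable_iff_integrableOn_Icc_of_le hT] at this

lemma deriv_primitive_ae {T : ℝ} (hT : 0 ≤ T) (b : H) {p : ℝ → H}
    (hp : MemLp p 2 (volume.restrict (Icc (0 : ℝ) T))) :
    ∀ᵐ t ∂(volume.restrict (Icc (0 : ℝ) T)), deriv (primitive b p) t = p t := by
  rw [ae_restrict_iff' measurableSet_Icc]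
  filter_upwards [hasDerivAt_primitive_ae b (intervalIntegrable_of_memLp hT hp)] with t ht h
  rw [uIcc_of_le hT] at ht
  exact (ht h).deriv

lemma memA2_primitive {T : ℝ} (hT : 0 ≤ T) (b : H) {p : ℝ → H}
    (hp : MemLp p 2 (volume.restrict (Icc (0 : ℝ) T))) : MemA2 T (primitive b p) where
  memLp_deriv := (memLp_congr_ae (deriv_primitive_ae hT b hp)).2 hp
  eq_integral t ht := by
    have h := (ae_restrict_iff' measurableSet_Icc).1 (deriv_primitive_ae hT b hp)
    rw [primitive_zero, primitive]
    congr 1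
    apply intervalIntegral.integral_congr_ae
    filter_upwards [h] with s hs hs'
    rw [uIoc_of_le ht.1] at hs'
    exact (hs ⟨hs'.1.le, hs'.2.trans ht.2⟩).symm

lemma MemA2.neg {T : ℝ} {u : ℝ → H} (hu : MemA2 T u) : MemA2 T (fun t => -u t) where
  memLp_deriv := by
    have : deriv (fun t => -u t) = -deriv u := by ext t; simp
    rw [this]; exact hu.memLp_deriv.neg
  eq_integral t ht := by
    simp only [deriv.fun_neg, intervalIntegral.integral_neg]
    rw [hu.eq_integral t ht]; abel

end Primitive

/-! ### Extended-real integrals -/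

section ExtIntegral

lemma extIntegral_mono {T : ℝ} {f g : ℝ → EReal}
    (h : ∀ᵐ t ∂(volume.restrict (Icc (0 : ℝ) T)), f t ≤ g t) :
    extIntegral T f ≤ extIntegral T g := by
  refine EReal.sub_le_sub ?_ ?_
  · exact_mod_cast lintegral_mono_ae (h.mono fun t ht => EReal.toENNReal_le_toENNReal ht)
  · exact_mod_cast lintegral_mono_ae
      (h.mono fun t ht => EReal.toENNReal_le_toENNReal (EReal.neg_le_neg_iff.2 ht))

lemma extIntegral_coe {T : ℝ} {g : ℝ → ℝ}
    (hg : Integrable g (volume.restrict (Icc (0 : ℝ) T))) :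
    extIntegral T (fun t => (g t : EReal)) = ((∫ t in Icc (0 : ℝ) T, g t : ℝ) : EReal) := by
  rw [integral_eq_lintegral_pos_part_sub_lintegral_neg_part hg, extIntegral]
  have h1 : ∫⁻ t in Icc (0 : ℝ) T, ENNReal.ofReal (g t) ≠ ⊤ := hg.lintegral_lt_top.ne
  have h2 : ∫⁻ t in Icc (0 : ℝ) T, ENNReal.ofReal (-g t) ≠ ⊤ := hg.neg.lintegral_lt_top.ne
  simp only [← EReal.coe_neg, EReal.toENNReal_of_ne_top (EReal.coe_ne_top _), EReal.toReal_coe]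
  rw [EReal.coe_sub, EReal.coe_ennreal_toReal h1, EReal.coe_ennreal_toReal h2]

/-- A function bounded below by an integrable function whose extended integral is bounded above
is almost everywhere finite, integrable, and has the expected integral. -/
lemma integrable_toReal_of_extIntegral_le {T : ℝ} {f : ℝ → EReal} {g : ℝ → ℝ} {c : ℝ}
    (hf : AEMeasurable f (volume.restrict (Icc (0 : ℝ) T)))
    (hg : Integrable g (volume.restrict (Icc (0 : ℝ) T)))
    (hgf : ∀ᵐ t ∂(volume.restrict (Icc (0 : ℝ) T)), (g t : EReal) ≤ f t)
    (hc : extIntegral T f ≤ c) :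
    (∀ᵐ t ∂(volume.restrict (Icc (0 : ℝ) T)), f t = ((f t).toReal : EReal)) ∧
    Integrable (fun t => (f t).toReal) (volume.restrict (Icc (0 : ℝ) T)) ∧
    extIntegral T f = ((∫ t in Icc (0 : ℝ) T, (f t).toReal : ℝ) : EReal) := by
  have hneg : ∫⁻ t in Icc (0 : ℝ) T, (-f t).toENNReal ≠ ⊤ := by
    refine ((lintegral_mono_ae (hgf.mono fun t ht => ?_)).trans_lt hg.neg.lintegral_lt_top).ne
    calc (-f t).toENNReal ≤ (-(g t : EReal)).toENNReal :=
          EReal.toENNReal_le_toENNReal (EReal.neg_le_neg_iff.2 ht)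
      _ = ENNReal.ofReal (-g t) := by
          rw [← EReal.coe_neg, EReal.toENNReal_of_ne_top (EReal.coe_ne_top _), EReal.toReal_coe]
  have hpos : ∫⁻ t in Icc (0 : ℝ) T, (f t).toENNReal ≠ ⊤ := by
    intro h
    rw [extIntegral, h, ← EReal.coe_ennreal_toReal hneg] at hc
    simp at hc
  have htop : ∀ᵐ t ∂(volume.restrict (Icc (0 : ℝ) T)), f t = ((f t).toReal : EReal) := by
    filter_upwards [ae_lt_top' hf.ereal_toENNReal hpos, hgf] with t h1 h2
    refine (EReal.coe_toReal (fun h => ?_) (fun h => ?_)).symm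
    · simp [h] at h1
    · simp [h] at h2
  have hint : Integrable (fun t => (f t).toReal) (volume.restrict (Icc (0 : ℝ) T)) := by
    have h1 : Integrable (fun t => ((f t).toENNReal).toReal)
        (volume.restrict (Icc (0 : ℝ) T)) := integrable_toReal_of_lintegral_ne_top
          hf.ereal_toENNReal hpos
    refine Integrable.mono' (h1.add hg.norm) hf.ereal_toReal.aestronglyMeasurable ?_
    filter_upwards [htop, hgf] with t h2 h3
    have h4 : g t ≤ (f t).toReal := by rw [h2] at h3; exact_mod_cast h3
    have h5 : (f t).toENNReal.toReal = max (f t).toReal 0 := by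
      rw [h2, EReal.toENNReal_of_ne_top (EReal.coe_ne_top _), EReal.toReal_coe,
        ENNReal.toReal_ofReal']
    rw [Pi.add_apply, h5, Real.norm_eq_abs, Real.norm_eq_abs]
    rcases le_total 0 (f t).toReal with h | h
    · rw [abs_of_nonneg h, max_eq_left h]; linarith [abs_nonneg (g t)]
    · rw [abs_of_nonpos h, max_eq_right h, abs_of_nonpos (h4.trans h)]; linarith
  refine ⟨htop, hint, ?_⟩
  rw [← extIntegral_coe hint]
  exact le_antisymm (extIntegral_mono (htop.mono fun t ht => ht.le))
    (extIntegral_mono (htop.mono fun t ht => ht.ge))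

end ExtIntegral

/-! ### Borel representatives and measurability from the graph -/

section Borel

/-- A function on `[0,T] × X` measurable for the product of the Lebesgue and the Borel
σ-algebras agrees, outside a null set of times, with a Borel function on `ℝ × X`. -/
lemma exists_measurable_ae_eq {X : Type*} [MeasurableSpace X] {T : ℝ} {F : ℝ → X → EReal}
    (hF : @Measurable (Icc (0 : ℝ) T × X) EReal
      (@Prod.instMeasurableSpace _ _ (lebesgueSets.comap Subtype.val) _) _
      (fun z => F z.1 z.2)) :
    ∃ G : ℝ × X → EReal, Measurable G ∧
      ∀ᵐ t ∂(volume.restrict (Icc (0 : ℝ) T)), ∀ z, F t z = G (t, z) := by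
  -- Sets that coincide with a Borel set off a null set of times, uniformly in `z`, form a σ-algebra
  -- containing the generating rectangles.
  let P : Set (Icc (0 : ℝ) T × X) → Prop := fun S => ∃ S' : Set (ℝ × X), MeasurableSet S' ∧
    ∀ᵐ t ∂(volume : Measure ℝ), ∀ (h : t ∈ Icc (0 : ℝ) T) (z : X), ((⟨t, h⟩, z) ∈ S ↔ (t, z) ∈ S')
  let m : MeasurableSpace (Icc (0 : ℝ) T × X) :=
    { MeasurableSet' := P
      measurableSet_empty := ⟨∅, MeasurableSet.empty, by simp⟩
      measurableSet_compl := by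
        rintro S ⟨S', hS', h⟩
        exact ⟨S'ᶜ, hS'.compl, h.mono fun t ht hT z => not_congr (ht hT z)⟩
      measurableSet_iUnion := by
        intro S hS
        choose S' hS' h using hS
        refine ⟨⋃ i, S' i, MeasurableSet.iUnion hS', ?_⟩
        filter_upwards [ae_all_iff.2 h] with t ht hT z
        simp only [mem_iUnion]
        exact exists_congr fun i => ht i hT z }
  have hle : @Prod.instMeasurableSpace _ _ (lebesgueSets.comap Subtype.val) _ ≤ m := by
    refine sup_le ?_ ?_
    · rintro _ ⟨_, ⟨N, hN, rfl⟩, rfl⟩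
      have hN' : NullMeasurableSet N (volume : Measure ℝ) := hN
      obtain ⟨N', -, hN'm, hNN'⟩ := hN'.exists_measurable_superset_ae_eq
      refine ⟨N' ×ˢ univ, hN'm.prod MeasurableSet.univ, ?_⟩
      filter_upwards [hNN'.mem_iff] with t ht hT z
      simp [ht]
    · rintro _ ⟨B, hB, rfl⟩
      exact ⟨univ ×ˢ B, MeasurableSet.univ.prod hB, by simp⟩
  have hP : ∀ q : ℚ, P {z | F z.1 z.2 < ((q : ℝ) : EReal)} := fun q =>
    hle _ (hF measurableSet_Iio)
  choose S hS hFS using hP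
  classical
  refine ⟨fun z => ⨅ q : ℚ, if z ∈ S q then ((q : ℝ) : EReal) else ⊤, ?_, ?_⟩
  · exact Measurable.iInf fun q => Measurable.ite (hS q) measurable_const measurable_const
  · rw [ae_restrict_iff' measurableSet_Icc]
    filter_upwards [ae_all_iff.2 hFS] with t ht hT z
    have h : ∀ q : ℚ, (t, z) ∈ S q ↔ F t z < ((q : ℝ) : EReal) := fun q => (ht q hT z).symm
    simp only [h]
    refine le_antisymm (le_iInf fun q => ?_) (le_of_forall_gt fun c hc => ?_)
    · split_ifs with hq
      · exact hq.le
      · exact le_top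
    · obtain ⟨q, h1, h2⟩ := EReal.lt_iff_exists_rat_btwn.1 hc
      exact (iInf_le _ q).trans_lt (by rwa [if_pos h1])

/-- A function whose graph is Borel is Borel. -/
lemma measurable_of_measurableSet_graph {X Y : Type*} [MeasurableSpace X] [StandardBorelSpace X]
    [MeasurableSpace Y] [StandardBorelSpace Y] {z : X → Y} {G : Set (X × Y)} {A : Set X}
    (hA : MeasurableSet A) (hG : MeasurableSet G)
    (hz : ∀ t ∈ A, ∀ y, (t, y) ∈ G ↔ y = z t) {y₀ : Y} (hz₀ : ∀ t ∉ A, z t = y₀) :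
    Measurable z := by
  intro B hB
  -- Lusin-Souslin: the projection is injective on a graph, so it maps this Borel set to a Borel
  -- set.
  have h1 : MeasurableSet (Prod.fst '' (G ∩ (A ×ˢ B))) := by
    refine (hG.inter (hA.prod hB)).image_of_measurable_injOn measurable_fst ?_
    rintro ⟨t, y⟩ ⟨h1, h2⟩ ⟨s, y'⟩ ⟨h3, h4⟩ rfl
    rw [(hz t h2.1 y).1 h1, (hz t h2.1 y').1 h3]
  have h2 : z ⁻¹' B = Prod.fst '' (G ∩ (A ×ˢ B)) ∪ (Aᶜ ∩ {_t | y₀ ∈ B}) := by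
    ext t
    by_cases ht : t ∈ A
    · simp [ht, hz t ht]
    · simp [ht, hz₀ t ht]
  rw [h2]
  exact h1.union (hA.compl.inter (MeasurableSet.const _))

end Borel

/-! ### Proximal points in Hilbert space -/

section Prox

/-- A closed convex set in `E × ℝ` (an epigraph) bounded below has a proximal point, at which the
shifted vector `ζ - ε • z` is a subgradient. -/
lemma exists_proximal_point {E : Type*} [NormedAddCommGroup E] [InnerProductSpace ℝ E]
    [CompleteSpace E] {P : Set (E × ℝ)} (hcl : IsClosed P) (hcv : Convex ℝ P) (hne : P.Nonempty)
    {k : ℝ} (hk : ∀ z ∈ P, -k ≤ z.2) {ε : ℝ} (hε : 0 < ε) (ζ : E) :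
    ∃ z ∈ P, ∀ z' ∈ P, z.2 + inner ℝ (ζ - ε • z.1) (z'.1 - z.1) ≤ z'.2 := by
  let Q : E × ℝ → ℝ := fun z => z.2 + ε / 2 * ‖z.1‖ ^ 2 - inner ℝ ζ z.1
  have hQc : Continuous Q := by fun_prop
  have hbdd : BddBelow (Q '' P) := by
    refine ⟨-k - ‖ζ‖ ^ 2 / (2 * ε), ?_⟩
    rintro _ ⟨z, hz, rfl⟩
    have h1 := hk z hz
    have h2 := real_inner_le_norm ζ z.1
    have h3 : ‖ζ‖ * ‖z.1‖ ≤ ‖ζ‖ ^ 2 / (2 * ε) + ε / 2 * ‖z.1‖ ^ 2 := by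
      have : ‖ζ‖ ^ 2 / (2 * ε) + ε / 2 * ‖z.1‖ ^ 2 - ‖ζ‖ * ‖z.1‖
        = (‖ζ‖ - ε * ‖z.1‖) ^ 2 / (2 * ε) := by field_simp; ring
      have h4 : 0 ≤ (‖ζ‖ - ε * ‖z.1‖) ^ 2 / (2 * ε) := by positivity
      linarith
    simp only [Q]; linarith
  set m := sInf (Q '' P) with hm
  have hmle : ∀ z ∈ P, m ≤ Q z := fun z hz => csInf_le hbdd ⟨z, hz, rfl⟩
  have hex : ∀ n : ℕ, ∃ z ∈ P, Q z < m + 1 / ((n : ℝ) + 1) := by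
    intro n
    obtain ⟨_, ⟨z, hz, rfl⟩, h⟩ := exists_lt_of_csInf_lt (hne.image Q)
      (show sInf (Q '' P) < m + 1 / ((n : ℝ) + 1) by
        have : (0 : ℝ) < 1 / ((n : ℝ) + 1) := by positivity
        linarith)
    exact ⟨z, hz, h⟩
  choose u huP hu using hex
  -- Strong convexity at the midpoint: near-minimizers of `Q` are close, so a minimizing sequence is
  -- Cauchy without any compactness.
  have hmid : ∀ z ∈ P, ∀ z' ∈ P, ε / 8 * ‖z.1 - z'.1‖ ^ 2 ≤ (Q z + Q z') / 2 - m := by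
    intro z hz z' hz'
    have h1 := hmle _ (hcv hz hz' (a := 1 / 2) (b := 1 / 2) (by norm_num) (by norm_num)
      (by norm_num))
    have h2 : Q ((1 / 2 : ℝ) • z + (1 / 2 : ℝ) • z')
        = (Q z + Q z') / 2 - ε / 8 * ‖z.1 - z'.1‖ ^ 2 := by
      simp only [Q, Prod.fst_add, Prod.smul_fst, Prod.snd_add, Prod.smul_snd, smul_eq_mul,
        inner_add_right, inner_smul_right]
      rw [← smul_add, norm_smul, mul_pow, norm_add_sq_real, norm_sub_sq_real]
      norm_num
      ring
    linarith
  have hcau : CauchySeq fun n => (u n).1 := by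
    refine cauchySeq_of_le_tendsto_0 (fun N : ℕ => Real.sqrt (8 / ε * (1 / ((N : ℝ) + 1)))) ?_ ?_
    · intro n j N hn hj
      rw [dist_eq_norm]
      apply Real.le_sqrt_of_sq_le
      have h1 := hmid _ (huP n) _ (huP j)
      have h2 : 1 / ((n : ℝ) + 1) ≤ 1 / ((N : ℝ) + 1) := by gcongr
      have h3 : 1 / ((j : ℝ) + 1) ≤ 1 / ((N : ℝ) + 1) := by gcongr
      have h4 := hu n
      have h5 := hu j
      have h6 : ε / 8 * ‖(u n).1 - (u j).1‖ ^ 2 ≤ 1 / ((N : ℝ) + 1) := by linarith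
      calc ‖(u n).1 - (u j).1‖ ^ 2 = 8 / ε * (ε / 8 * ‖(u n).1 - (u j).1‖ ^ 2) := by
            field_simp
        _ ≤ _ := by gcongr
    · have := (tendsto_one_div_add_atTop_nhds_zero_nat (𝕜 := ℝ)).const_mul (8 / ε)
      simpa [Function.comp_def] using (Real.continuous_sqrt.tendsto _).comp this
  obtain ⟨z, hz⟩ := cauchySeq_tendsto_of_complete hcau
  have hQu : Tendsto (fun n => Q (u n)) atTop (𝓝 m) := by
    have := (tendsto_one_div_add_atTop_nhds_zero_nat (𝕜 := ℝ)).const_add m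
    rw [add_zero] at this
    exact tendsto_of_tendsto_of_tendsto_of_le_of_le tendsto_const_nhds this
      (fun n => hmle _ (huP n)) (fun n => (hu n).le)
  have hr : Tendsto (fun n => (u n).2) atTop (𝓝 (m - ε / 2 * ‖z‖ ^ 2 + inner ℝ ζ z)) := by
    have h : Tendsto (fun n => Q (u n) - ε / 2 * ‖(u n).1‖ ^ 2 + inner ℝ ζ (u n).1) atTop
        (𝓝 (m - ε / 2 * ‖z‖ ^ 2 + inner ℝ ζ z)) :=
      (hQu.sub ((hz.norm.pow 2).const_mul _)).add (tendsto_const_nhds.inner hz)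
    refine h.congr fun n => ?_
    simp only [Q]; ring
  set r := m - ε / 2 * ‖z‖ ^ 2 + inner ℝ ζ z with hrdef
  have hzP : (z, r) ∈ P := hcl.mem_of_tendsto (hz.prodMk_nhds hr) (Eventually.of_forall huP)
  refine ⟨(z, r), hzP, fun z' hz' => ?_⟩
  -- First variation of `Q` along the segment to `z'`: the increment is `s` times this expression,
  -- whose limit as `s → 0` is the subgradient inequality.
  have key : ∀ s : ℝ, 0 < s → s ≤ 1 →
      0 ≤ (z'.2 - r - inner ℝ (ζ - ε • z) (z'.1 - z)) + s * (ε / 2 * ‖z'.1 - z‖ ^ 2) := by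
    intro s hs hs1
    have h1 := hmle _ (hcv hzP hz' (a := 1 - s) (b := s) (by linarith) hs.le (by ring))
    have h2 : Q ((1 - s) • (z, r) + s • z') = m +
        s * ((z'.2 - r - inner ℝ (ζ - ε • z) (z'.1 - z)) + s * (ε / 2 * ‖z'.1 - z‖ ^ 2)) := by
      have h3 : (1 - s) • z + s • z'.1 = z + s • (z'.1 - z) := by module
      simp only [Q, Prod.fst_add, Prod.smul_fst, Prod.snd_add, Prod.smul_snd, smul_eq_mul]
      rw [h3, norm_add_sq_real, norm_smul, mul_pow, inner_smul_right, inner_add_right,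
        inner_smul_right, inner_sub_left, inner_smul_left, Real.norm_eq_abs, sq_abs, hrdef]
      simp only [conj_trivial]
      ring
    rw [h2] at h1
    have h4 : 0 ≤ s * ((z'.2 - r - inner ℝ (ζ - ε • z) (z'.1 - z))
        + s * (ε / 2 * ‖z'.1 - z‖ ^ 2)) := by linarith
    exact nonneg_of_mul_nonneg_right h4 hs
  have hlim : Tendsto (fun s : ℝ => (z'.2 - r - inner ℝ (ζ - ε • z) (z'.1 - z))
      + s * (ε / 2 * ‖z'.1 - z‖ ^ 2)) (𝓝[>] 0)
      (𝓝 ((z'.2 - r - inner ℝ (ζ - ε • z) (z'.1 - z)) + 0 * (ε / 2 * ‖z'.1 - z‖ ^ 2))) :=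
    ((continuous_const.add (continuous_id.mul continuous_const)).tendsto _).mono_left
      nhdsWithin_le_nhds
  have := ge_of_tendsto hlim (by
    filter_upwards [Ioc_mem_nhdsGT (zero_lt_one' ℝ)] with s hs using key s hs.1 hs.2)
  simp only
  linarith

end Prox

/-! ### Fenchel's inequality and proximal points of an anti-self dual Lagrangian -/

section Lagrangian

variable {H : Type*} [NormedAddCommGroup H] [InnerProductSpace ℝ H] {f : H → H → EReal}

lemma le_legendre (q y : H) {x p : H} {r : ℝ} (h : f x p ≤ r) :
    ((inner ℝ q x + inner ℝ y p - r : ℝ) : EReal) ≤ legendre f q y := by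
  refine le_trans ?_ (le_iSup₂ (f := fun x p => ((inner ℝ q x + inner ℝ y p : ℝ) : EReal) - f x p)
    x p)
  rw [EReal.coe_sub]
  exact EReal.sub_le_sub le_rfl h

lemma legendre_le {q y : H} {c : ℝ}
    (h : ∀ x p (r : ℝ), f x p ≤ r → inner ℝ q x + inner ℝ y p - r ≤ c) (hb : ∀ x p, f x p ≠ ⊥) :
    legendre f q y ≤ c := by
  refine iSup₂_le fun x p => ?_
  rcases eq_or_ne (f x p) ⊤ with ht | ht
  · simp [ht]
  · rw [← EReal.coe_toReal ht (hb x p), ← EReal.coe_sub]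
    exact_mod_cast h x p _ (EReal.coe_toReal ht (hb x p)).ge

lemma IsConvexLagrangian.isClosed_epigraph (hf : IsConvexLagrangian f) :
    IsClosed {z : (H × H) × ℝ | f z.1.1 z.1.2 ≤ (z.2 : EReal)} := by
  have h := hf.lsc.isClosed_epigraph
  have hc : Continuous fun z : (H × H) × ℝ => (z.1, (z.2 : EReal)) :=
    continuous_fst.prodMk (continuous_coe_real_ereal.comp continuous_snd)
  exact h.preimage hc

/-- Fenchel's inequality for an anti-self dual Lagrangian. -/
lemma fenchel_of_antiselfdual (ha : ∀ p x : H, legendre f p x = f (-x) (-p)) {x p x' p' : H}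
    {r r' : ℝ} (h : f x p ≤ r) (h' : f x' p' ≤ r') : -inner ℝ x p' - inner ℝ x' p ≤ r + r' := by
  have h1 := (le_legendre (-p') (-x') h).trans_eq (ha _ _)
  rw [neg_neg, neg_neg] at h1
  have h2 : inner ℝ (-p') x + inner ℝ (-x') p - r ≤ r' := by exact_mod_cast h1.trans h'
  rw [inner_neg_left, inner_neg_left, real_inner_comm] at h2
  linarith

/-- Fenchel's inequality with both points equal to `(x, p)`. -/
lemma neg_inner_le_of_antiselfdual (hf : IsConvexLagrangian f)
    (ha : ∀ p x : H, legendre f p x = f (-x) (-p)) (x p : H) :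
    ((-inner ℝ x p : ℝ) : EReal) ≤ f x p := by
  rcases eq_or_ne (f x p) ⊤ with ht | ht
  · simp [ht]
  · have e := EReal.coe_toReal ht (hf.ne_bot x p)
    have := fenchel_of_antiselfdual ha e.ge e.ge
    rw [← e]
    exact_mod_cast (by linarith : -inner ℝ x p ≤ (f x p).toReal)

/-- `z` is the proximal point of `(q, y)`: `(q, y) - ε z` is a subgradient of `f` at `z`, in a form
which by anti-self duality involves only values of `f`. -/
def IsProx (f : H → H → EReal) (ε : ℝ) (q y : H) (z : H × H) : Prop :=
  f z.1 z.2 ≠ ⊤ ∧ f (-(y - ε • z.2)) (-(q - ε • z.1)) ≠ ⊤ ∧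
    (f z.1 z.2).toReal + (f (-(y - ε • z.2)) (-(q - ε • z.1))).toReal
      ≤ inner ℝ (q - ε • z.1) z.1 + inner ℝ (y - ε • z.2) z.2

lemma IsProx.subgradient (hf : IsConvexLagrangian f)
    (ha : ∀ p x : H, legendre f p x = f (-x) (-p)) {ε : ℝ} {q y : H} {z : H × H}
    (hz : IsProx f ε q y z) {x p : H} {r : ℝ} (h : f x p ≤ r) :
    (f z.1 z.2).toReal + (inner ℝ (q - ε • z.1) (x - z.1) + inner ℝ (y - ε • z.2) (p - z.2))
      ≤ r := by
  obtain ⟨h1, h2, h3⟩ := hz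
  have h4 := fenchel_of_antiselfdual ha h (EReal.coe_toReal h2 (hf.ne_bot _ _)).ge
  rw [inner_neg_left, inner_neg_right, real_inner_comm] at h4
  rw [inner_sub_right, inner_sub_right]
  linarith

/-- Adding the two subgradient inequalities leaves `ε ‖z - z'‖² ≤ 0`. Uniqueness is what replaces a
measurable selection theorem below. -/
lemma IsProx.unique (hf : IsConvexLagrangian f)
    (ha : ∀ p x : H, legendre f p x = f (-x) (-p)) {ε : ℝ} (hε : 0 < ε) {q y : H} {z z' : H × H}
    (hz : IsProx f ε q y z) (hz' : IsProx f ε q y z') : z = z' := by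
  have h1 := hz.subgradient hf ha (EReal.coe_toReal hz'.1 (hf.ne_bot _ _)).ge
  have h2 := hz'.subgradient hf ha (EReal.coe_toReal hz.1 (hf.ne_bot _ _)).ge
  have h3 : ε * (‖z.1 - z'.1‖ ^ 2 + ‖z.2 - z'.2‖ ^ 2) ≤ 0 := by
    rw [norm_sub_sq_real, norm_sub_sq_real]
    simp only [inner_sub_left, inner_sub_right, inner_smul_left, conj_trivial,
      real_inner_self_eq_norm_sq, real_inner_comm z.1 z'.1, real_inner_comm z.2 z'.2] at h1 h2
    linarith
  have h4 : ‖z.1 - z'.1‖ ^ 2 + ‖z.2 - z'.2‖ ^ 2 ≤ 0 := nonpos_of_mul_nonpos_right h3 hε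
  have h5 : ‖z.1 - z'.1‖ = 0 := by nlinarith [sq_nonneg ‖z.1 - z'.1‖, sq_nonneg ‖z.2 - z'.2‖]
  have h6 : ‖z.2 - z'.2‖ = 0 := by nlinarith [sq_nonneg ‖z.1 - z'.1‖, sq_nonneg ‖z.2 - z'.2‖]
  exact Prod.ext (sub_eq_zero.1 (norm_eq_zero.1 h5)) (sub_eq_zero.1 (norm_eq_zero.1 h6))

lemma exists_isProx [CompleteSpace H] (hf : IsConvexLagrangian f)
    (ha : ∀ p x : H, legendre f p x = f (-x) (-p)) {k : ℝ} (hk : f 0 0 ≤ k) {ε : ℝ} (hε : 0 < ε)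
    (q y : H) : ∃ z, IsProx f ε q y z := by
  -- The product `H × H` carries the sup norm; minimization needs the Hilbert norm. The lower bound
  -- `-k` is Fenchel's inequality against the point `(0, 0)`.
  let P : Set (WithLp 2 (H × H) × ℝ) := {z | f z.1.fst z.1.snd ≤ (z.2 : EReal)}
  let A : (WithLp 2 (H × H) × ℝ) →L[ℝ] (H × H) × ℝ :=
    (WithLp.prodContinuousLinearEquiv 2 ℝ H H : WithLp 2 (H × H) →L[ℝ] H × H).prodMap
      (ContinuousLinearMap.id ℝ ℝ)
  have hPA : P = A ⁻¹' {z : (H × H) × ℝ | f z.1.1 z.1.2 ≤ (z.2 : EReal)} := rfl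
  obtain ⟨z, hz, hmin⟩ := exists_proximal_point (P := P) (k := k)
    (by rw [hPA]; exact hf.isClosed_epigraph.preimage A.continuous)
    (by rw [hPA]; exact hf.convex_epigraph.linear_preimage A.toLinearMap)
    ⟨(0, k), hk⟩
    (fun z hz => by
      have := fenchel_of_antiselfdual ha hz hk
      simp only [inner_zero_left, inner_zero_right] at this
      linarith) hε (WithLp.toLp 2 (q, y))
  have hztop : f z.1.fst z.1.snd ≠ ⊤ := fun h => by simp [P, h] at hz
  have hle : legendre f (q - ε • z.1.fst) (y - ε • z.1.snd) ≤
      ((inner ℝ (q - ε • z.1.fst) z.1.fst + inner ℝ (y - ε • z.1.snd) z.1.snd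
        - (f z.1.fst z.1.snd).toReal : ℝ) : EReal) := by
    refine legendre_le (fun x p r h => ?_) hf.ne_bot
    have h1 := hmin (WithLp.toLp 2 (x, p), r) h
    have h2 : (f z.1.fst z.1.snd).toReal ≤ z.2 := by
      have h3 : f z.1.fst z.1.snd ≤ z.2 := hz
      rw [← EReal.coe_toReal hztop (hf.ne_bot _ _)] at h3
      exact_mod_cast h3
    simp only [WithLp.prod_inner_apply, inner_sub_right, WithLp.ofLp_sub, WithLp.ofLp_smul,
      Prod.fst_sub, Prod.snd_sub, Prod.smul_fst, Prod.smul_snd] at h1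
    change z.2 + (inner ℝ (q - ε • z.1.fst) x + inner ℝ (y - ε • z.1.snd) p -
      (inner ℝ (q - ε • z.1.fst) z.1.fst + inner ℝ (y - ε • z.1.snd) z.1.snd)) ≤ r at h1
    linarith
  rw [ha] at hle
  refine ⟨(z.1.fst, z.1.snd), hztop, fun h => ?_, ?_⟩
  · simp only at h
    rw [h] at hle
    exact EReal.coe_ne_top _ (top_le_iff.1 hle)
  · rw [← EReal.coe_toReal (ne_top_of_le_ne_top (EReal.coe_ne_top _) hle) (hf.ne_bot _ _)] at hle
    have := EReal.coe_le_coe_iff.1 hle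
    simp only
    linarith

end Lagrangian

/-! ### Measurability in time -/

section Selection

variable {H : Type*} [NormedAddCommGroup H] [InnerProductSpace ℝ H] [CompleteSpace H]
  [SecondCountableTopology H] [MeasurableSpace H] [BorelSpace H]
  {T : ℝ} {L : ℝ → H → H → EReal}

omit [CompleteSpace H] in
lemma IsASDLagrangian.exists_borel (hL : IsASDLagrangian T L) :
    ∃ G : ℝ × (H × H) → EReal, Measurable G ∧
      ∀ᵐ t ∂(volume.restrict (Icc (0 : ℝ) T)), ∀ z : H × H, L t z.1 z.2 = G (t, z) := by
  have h := hL.measurable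
  rw [← BorelSpace.measurable_eq (α := H × H)] at h
  exact exists_measurable_ae_eq (F := fun t (z : H × H) => L t z.1 z.2) h

omit [CompleteSpace H] in
-- The null set on which `L` differs from its Borel version consists of times only, so any
-- measurable field can be substituted.
lemma IsASDLagrangian.aemeasurable_comp (hL : IsASDLagrangian T L) {x w : ℝ → H}
    (hx : AEStronglyMeasurable x (volume.restrict (Icc (0 : ℝ) T)))
    (hw : AEStronglyMeasurable w (volume.restrict (Icc (0 : ℝ) T))) :
    AEMeasurable (fun t => L t (x t) (w t)) (volume.restrict (Icc (0 : ℝ) T)) := by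
  obtain ⟨G, hG, h⟩ := hL.exists_borel
  have h1 : AEMeasurable (fun t => G (t, (x t, w t))) (volume.restrict (Icc (0 : ℝ) T)) :=
    hG.comp_aemeasurable (aemeasurable_id.prodMk (hx.aemeasurable.prodMk hw.aemeasurable))
  exact h1.congr (h.mono fun t ht => (ht (x t, w t)).symm)

/-- For almost every `t` the proximal point exists and is unique, and `IsProx` is a Borel condition
since it involves only values of `L`. The field thus has a Borel graph. -/
lemma IsASDLagrangian.exists_measurable_isProx (hL : IsASDLagrangian T L)
    (h0 : ∀ᵐ t ∂(volume.restrict (Icc (0 : ℝ) T)), L t 0 0 ≠ ⊤) {ε : ℝ} (hε : 0 < ε)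
    {q y : ℝ → H} (hq : AEStronglyMeasurable q (volume.restrict (Icc (0 : ℝ) T)))
    (hy : AEStronglyMeasurable y (volume.restrict (Icc (0 : ℝ) T))) :
    ∃ z : ℝ → H × H, Measurable z ∧
      ∀ᵐ t ∂(volume.restrict (Icc (0 : ℝ) T)), IsProx (L t) ε (q t) (y t) (z t) := by
  obtain ⟨G, hG, hLG⟩ := hL.exists_borel
  have hqm := hq.stronglyMeasurable_mk.measurable
  have hym := hy.stronglyMeasurable_mk.measurable
  have hgood : ∀ᵐ t ∂(volume.restrict (Icc (0 : ℝ) T)), t ∈ Icc (0 : ℝ) T ∧ L t 0 0 ≠ ⊤ ∧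
      (∀ z : H × H, L t z.1 z.2 = G (t, z)) ∧ q t = hq.mk q t ∧ y t = hy.mk y t := by
    filter_upwards [ae_restrict_mem measurableSet_Icc, h0, hLG, hq.ae_eq_mk, hy.ae_eq_mk]
      with t h1 h2 h3 h4 h5 using ⟨h1, h2, h3, h4, h5⟩
  -- All exceptional times are put into one Borel null set `N`, where the field is set to `0`.
  obtain ⟨N, hNsub, hN, hN0⟩ := exists_measurable_superset_of_null (ae_iff.1 hgood)
  have hA : ∀ t ∈ Nᶜ, t ∈ Icc (0 : ℝ) T ∧ L t 0 0 ≠ ⊤ ∧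
      (∀ z : H × H, L t z.1 z.2 = G (t, z)) ∧ q t = hq.mk q t ∧ y t = hy.mk y t := by
    intro t ht
    by_contra hcon
    exact ht (hNsub hcon)
  have hex : ∀ t ∈ Nᶜ, ∃ z, IsProx (L t) ε (q t) (y t) z := by
    intro t ht
    obtain ⟨h1, h2, -⟩ := hA t ht
    exact exists_isProx (hL.lagrangian t h1) (hL.antiselfdual t h1)
      (EReal.coe_toReal h2 ((hL.lagrangian t h1).ne_bot _ _)).ge hε _ _
  classical
  let z : ℝ → H × H := fun t => if ht : t ∈ Nᶜ then (hex t ht).choose else 0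
  have hz : ∀ t ∈ Nᶜ, IsProx (L t) ε (q t) (y t) (z t) := by
    intro t ht
    simp only [z, dif_pos ht]
    exact (hex t ht).choose_spec
  refine ⟨z, ?_, ?_⟩
  · refine measurable_of_measurableSet_graph (A := Nᶜ) (y₀ := 0)
      (G := {s | IsProx (fun a b => G (s.1, (a, b))) ε (hq.mk q s.1) (hy.mk y s.1) s.2})
      hN.compl ?_ ?_ ?_
    · have m1 : Measurable fun s : ℝ × (H × H) => hq.mk q s.1 - ε • s.2.1 :=
        (hqm.comp measurable_fst).sub ((measurable_fst.comp measurable_snd).const_smul ε)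
      have m2 : Measurable fun s : ℝ × (H × H) => hy.mk y s.1 - ε • s.2.2 :=
        (hym.comp measurable_fst).sub ((measurable_snd.comp measurable_snd).const_smul ε)
      have m3 : Measurable fun s : ℝ × (H × H) => G (s.1, (s.2.1, s.2.2)) := hG
      have m4 : Measurable fun s : ℝ × (H × H) =>
          G (s.1, (-(hy.mk y s.1 - ε • s.2.2), -(hq.mk q s.1 - ε • s.2.1))) :=
        hG.comp (measurable_fst.prodMk (m2.neg.prodMk m1.neg))
      have m5 : Measurable fun s : ℝ × (H × H) => s.2.1 := measurable_fst.comp measurable_snd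
      have m6 : Measurable fun s : ℝ × (H × H) => s.2.2 := measurable_snd.comp measurable_snd
      exact (m3 (measurableSet_singleton ⊤).compl).inter
        ((m4 (measurableSet_singleton ⊤).compl).inter
          (measurableSet_le (m3.ereal_toReal.add m4.ereal_toReal)
            ((m1.inner m5).add (m2.inner m6))))
    · intro t ht b
      obtain ⟨h1, h2, h3, h4, h5⟩ := hA t ht
      have e : (fun a b => G (t, (a, b))) = L t := by
        ext a b; exact (h3 (a, b)).symm
      simp only [mem_ofPred_eq, e, ← h4, ← h5]
      exact ⟨fun hb => hb.unique (hL.lagrangian t h1) (hL.antiselfdual t h1) hε (hz t ht),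
        fun hb => hb ▸ hz t ht⟩
    · intro t ht
      simp only [z, dif_neg ht]
  · have : ∀ᵐ t ∂(volume.restrict (Icc (0 : ℝ) T)), t ∈ Nᶜ := by
      rw [ae_iff]; simpa using hN0
    exact this.mono hz

end Selection

/-! ### Interchange of supremum and integral -/

section Interchange

variable {H : Type*} [NormedAddCommGroup H] [InnerProductSpace ℝ H]

/-- Completing the square, `‖a‖² - ⟨a, b⟩ ≥ -‖b‖² / 4`, bounds the loss due to regularization. At
`(x, p) = (0, 0)` it shows that the right side plus any bound for `f 0 0` is nonnegative. -/
lemma IsProx.add_nonneg {f : H → H → EReal} (hf : IsConvexLagrangian f)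
    (ha : ∀ p x : H, legendre f p x = f (-x) (-p)) {ε : ℝ} (hε : 0 < ε) {q y : H} {z : H × H}
    (hz : IsProx f ε q y z) {x p : H} {r : ℝ} (h : f x p ≤ r) :
    inner ℝ q x + inner ℝ y p - r - ε * (‖x‖ ^ 2 + ‖p‖ ^ 2) / 4 ≤
      inner ℝ q z.1 + inner ℝ y z.2 - (f z.1 z.2).toReal := by
  have h1 := hz.subgradient hf ha h
  have key : ∀ a b : H, -(‖b‖ ^ 2 / 4) ≤ inner ℝ a a - inner ℝ a b := by
    intro a b
    have h2 : 0 ≤ ‖a - (1 / 2 : ℝ) • b‖ ^ 2 := by positivity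
    rw [norm_sub_sq_real, norm_smul, inner_smul_right, mul_pow] at h2
    norm_num at h2
    rw [real_inner_self_eq_norm_sq]
    linarith
  have h2 := mul_le_mul_of_nonneg_left (key z.1 x) hε.le
  have h3 := mul_le_mul_of_nonneg_left (key z.2 p) hε.le
  simp only [inner_sub_left, inner_sub_right, inner_smul_left, conj_trivial] at h1
  linarith

/-- Each fixed competitor loses only a multiple of `1 / (n + 1)`, so the regularized values dominate
the conjugate in the limit. The shift by `k` makes room for Fatou's lemma in `ENNReal`. -/
lemma le_liminf_of_isProx {f : H → H → EReal} (hf : IsConvexLagrangian f)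
    (ha : ∀ p x : H, legendre f p x = f (-x) (-p)) {q y : H} {z : ℕ → H × H}
    (hz : ∀ n : ℕ, IsProx f (1 / ((n : ℝ) + 1)) q y (z n)) {k : ℝ}
    (hfin : liminf (fun n => ENNReal.ofReal
      (inner ℝ q (z n).1 + inner ℝ y (z n).2 - (f (z n).1 (z n).2).toReal + k)) atTop ≠ ⊤) :
    f (-y) (-q) ≤ (((liminf (fun n => ENNReal.ofReal
      (inner ℝ q (z n).1 + inner ℝ y (z n).2 - (f (z n).1 (z n).2).toReal + k))
        atTop).toReal - k : ℝ) : EReal) := by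
  rw [← ha]
  refine legendre_le (fun x p r h => ?_) hf.ne_bot
  have hlim : Tendsto (fun n : ℕ => ENNReal.ofReal (inner ℝ q x + inner ℝ y p - r
      - 1 / ((n : ℝ) + 1) * ((‖x‖ ^ 2 + ‖p‖ ^ 2) / 4) + k)) atTop
      (𝓝 (ENNReal.ofReal (inner ℝ q x + inner ℝ y p - r
        - 0 * ((‖x‖ ^ 2 + ‖p‖ ^ 2) / 4) + k))) :=
    ENNReal.tendsto_ofReal (((tendsto_one_div_add_atTop_nhds_zero_nat.mul_const _).const_sub
      _).add_const _)
  have h1 : ENNReal.ofReal (inner ℝ q x + inner ℝ y p - r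
      - 0 * ((‖x‖ ^ 2 + ‖p‖ ^ 2) / 4) + k) ≤ liminf (fun n => ENNReal.ofReal
      (inner ℝ q (z n).1 + inner ℝ y (z n).2 - (f (z n).1 (z n).2).toReal + k)) atTop := by
    rw [← hlim.liminf_eq]
    refine liminf_le_liminf (Eventually.of_forall fun n => ENNReal.ofReal_le_ofReal ?_)
    have := (hz n).add_nonneg hf ha (by positivity) h
    linarith
  have h2 := (ENNReal.ofReal_le_iff_le_toReal hfin).1 h1
  linarith

lemma integrable_inner_of_memLp {α : Type*} [MeasurableSpace α] {μ : Measure α} {q x : α → H}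
    (hq : MemLp q 2 μ) (hx : MemLp x 2 μ) : Integrable (fun t => inner ℝ (q t) (x t)) μ :=
  (hq.norm.integrable_mul hx.norm).mono' (hq.1.inner hx.1)
    (ae_of_all _ fun _ => norm_inner_le_norm _ _)

lemma lintegral_le_of_le_liminf {α : Type*} [MeasurableSpace α] {μ : Measure α}
    {F : α → ENNReal} {G : ℕ → α → ENNReal} {c : ENNReal} (hG : ∀ n, AEMeasurable (G n) μ)
    (hc : ∀ n, ∫⁻ t, G n t ∂μ ≤ c) (hF : ∀ᵐ t ∂μ, F t ≤ liminf (fun n => G n t) atTop) :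
    ∫⁻ t, F t ∂μ ≤ c :=
  (lintegral_mono_ae hF).trans <| (lintegral_liminf_le' hG).trans <|
    liminf_le_of_le (by isBoundedDefault) fun _ hb =>
      (hb.exists.choose_spec).trans (hc _)

variable [CompleteSpace H] [SecondCountableTopology H] {T : ℝ} {L : ℝ → H → H → EReal}

omit [CompleteSpace H] in
/-- The value at a measurable field of proximal points, reached by truncating that field. -/
lemma lintegral_isProx_le (hL : IsASDLagrangian T L) {k : ℝ → ℝ}
    (hk : Integrable k (volume.restrict (Icc (0 : ℝ) T)))
    (hLk : ∀ᵐ t ∂(volume.restrict (Icc (0 : ℝ) T)), L t 0 0 ≤ k t) {q y : ℝ → H}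
    (hq : MemLp q 2 (volume.restrict (Icc (0 : ℝ) T)))
    (hy : MemLp y 2 (volume.restrict (Icc (0 : ℝ) T))) {c : ℝ}
    (h : ∀ x w : ℝ → H, MemLp x 2 (volume.restrict (Icc (0 : ℝ) T)) →
      MemLp w 2 (volume.restrict (Icc (0 : ℝ) T)) → ∀ g : ℝ → ℝ,
      Integrable g (volume.restrict (Icc (0 : ℝ) T)) →
      (∀ᵐ t ∂(volume.restrict (Icc (0 : ℝ) T)), L t (x t) (w t) ≤ g t) →
      (∫ t in Icc (0 : ℝ) T, (inner ℝ (q t) (x t) + inner ℝ (y t) (w t)))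
        - ∫ t in Icc (0 : ℝ) T, g t ≤ c) {ε : ℝ} (hε : 0 < ε) {z : ℝ → H × H}
    (hz : StronglyMeasurable z)
    (hprox : ∀ᵐ t ∂(volume.restrict (Icc (0 : ℝ) T)), IsProx (L t) ε (q t) (y t) (z t)) :
    ∫⁻ t in Icc (0 : ℝ) T, ENNReal.ofReal (inner ℝ (q t) (z t).1 + inner ℝ (y t) (z t).2
      - (L t (z t).1 (z t).2).toReal + k t)
      ≤ ENNReal.ofReal (c + ∫ t in Icc (0 : ℝ) T, k t) := by
  borelize H
  have hz1 : AEStronglyMeasurable (fun t => (z t).1) (volume.restrict (Icc (0 : ℝ) T)) :=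
    hz.measurable.fst.aestronglyMeasurable
  have hz2 : AEStronglyMeasurable (fun t => (z t).2) (volume.restrict (Icc (0 : ℝ) T)) :=
    hz.measurable.snd.aestronglyMeasurable
  set F : ℝ → ℝ := fun t => inner ℝ (q t) (z t).1 + inner ℝ (y t) (z t).2
      - (L t (z t).1 (z t).2).toReal + k t with hFdef
  have hF : AEStronglyMeasurable F (volume.restrict (Icc (0 : ℝ) T)) :=
    ((((hq.1.inner hz1).add (hy.1.inner hz2))).sub
      (hL.aemeasurable_comp hz1 hz2).ereal_toReal.aestronglyMeasurable).add hk.1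
  have hF0 : ∀ᵐ t ∂(volume.restrict (Icc (0 : ℝ) T)), 0 ≤ F t := by
    filter_upwards [hprox, hLk, ae_restrict_mem measurableSet_Icc] with t h1 h2 h3
    have := h1.add_nonneg (hL.lagrangian t h3) (hL.antiselfdual t h3) hε h2
    simp only [inner_zero_right, norm_zero] at this
    simp only [hFdef]
    linarith
  let A : ℕ → Set ℝ := fun N => {t | ‖z t‖ ≤ N}
  have hA : ∀ N, MeasurableSet (A N) := fun N =>
    measurableSet_le hz.norm.measurable measurable_const
  refine lintegral_le_of_le_liminf (G := fun N t => ENNReal.ofReal ((A N).indicator F t))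
    (fun N => (hF.aemeasurable.indicator (hA N)).ennreal_ofReal) (fun N => ?_) ?_
  · let x : ℝ → H := (A N).indicator fun t => (z t).1
    let w : ℝ → H := (A N).indicator fun t => (z t).2
    have hx : MemLp x 2 (volume.restrict (Icc (0 : ℝ) T)) := by
      refine MemLp.of_bound (hz1.indicator (hA N)) N (ae_of_all _ fun t => ?_)
      by_cases ht : t ∈ A N
      · simpa only [x, indicator_of_mem ht] using (norm_fst_le (z t)).trans ht
      · simp [x, indicator_of_notMem ht]
    have hw : MemLp w 2 (volume.restrict (Icc (0 : ℝ) T)) := by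
      refine MemLp.of_bound (hz2.indicator (hA N)) N (ae_of_all _ fun t => ?_)
      by_cases ht : t ∈ A N
      · simpa only [w, indicator_of_mem ht] using (norm_snd_le (z t)).trans ht
      · simp [w, indicator_of_notMem ht]
    -- On `A N` the bound `L ≥ -⟨x, p⟩` controls `F` from above.
    have hI : Integrable ((A N).indicator F) (volume.restrict (Icc (0 : ℝ) T)) := by
      refine Integrable.mono' (g := fun t => ‖q t‖ * N + ‖y t‖ * N + (N : ℝ) * N + ‖k t‖)
        (((((hq.integrable (by norm_num)).norm.mul_const _).add
          ((hy.integrable (by norm_num)).norm.mul_const _)).add (integrable_const _)).add hk.norm)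
        (hF.indicator (hA N)) ?_
      filter_upwards [hF0, hprox, ae_restrict_mem measurableSet_Icc] with t h1 h2 h3
      by_cases ht : t ∈ A N
      · have b1 : ‖(z t).1‖ ≤ N := (norm_fst_le (z t)).trans ht
        have b2 : ‖(z t).2‖ ≤ N := (norm_snd_le (z t)).trans ht
        rw [indicator_of_mem ht, Real.norm_eq_abs, abs_of_nonneg h1]
        have h4 := neg_inner_le_of_antiselfdual (hL.lagrangian t h3) (hL.antiselfdual t h3)
          (z t).1 (z t).2
        rw [← EReal.coe_toReal h2.1 ((hL.lagrangian t h3).ne_bot _ _)] at h4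
        have h5 := EReal.coe_le_coe_iff.1 h4
        have h6 : inner ℝ (q t) (z t).1 ≤ ‖q t‖ * N := (real_inner_le_norm _ _).trans (by gcongr)
        have h7 : inner ℝ (y t) (z t).2 ≤ ‖y t‖ * N := (real_inner_le_norm _ _).trans (by gcongr)
        have h8 : inner ℝ (z t).1 (z t).2 ≤ (N : ℝ) * N :=
          (real_inner_le_norm _ _).trans (by gcongr)
        have h9 := Real.le_norm_self (k t)
        simp only [hFdef]
        linarith
      · rw [indicator_of_notMem ht, norm_zero]
        positivity
    have hS : Integrable (fun t => inner ℝ (q t) (x t) + inner ℝ (y t) (w t))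
        (volume.restrict (Icc (0 : ℝ) T)) := 
        (integrable_inner_of_memLp hq hx).add (integrable_inner_of_memLp hy hw)
    -- This majorant equals the Lagrangian at `z t` on `A N`, and equals `k` off it, where the
    -- truncated field is `0`.
    have h1 := h x w hx hw (fun t => inner ℝ (q t) (x t) + inner ℝ (y t) (w t)
      - (A N).indicator F t + k t) ((hS.sub hI).add hk) (by
        filter_upwards [hLk, hprox, ae_restrict_mem measurableSet_Icc] with t h1 h2 h3
        by_cases ht : t ∈ A N
        · simp only [x, w, indicator_of_mem ht, hFdef]
          refine (EReal.coe_toReal h2.1 ((hL.lagrangian t h3).ne_bot _ _)).ge.trans ?_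
          exact EReal.coe_le_coe_iff.2 (by linarith)
        · simpa [x, w, indicator_of_notMem ht] using h1)
    rw [integral_add (f := fun t => inner ℝ (q t) (x t) + inner ℝ (y t) (w t)
      - (A N).indicator F t) (hS.sub hI) hk, integral_sub hS hI] at h1
    rw [← ofReal_integral_eq_lintegral_ofReal hI
      (hF0.mono fun t ht => indicator_apply_nonneg fun _ => ht)]
    exact ENNReal.ofReal_le_ofReal (by linarith)
  · refine ae_of_all _ fun t => ?_
    have : Tendsto (fun N : ℕ => ENNReal.ofReal ((A N).indicator F t)) atTop
        (𝓝 (ENNReal.ofReal (F t))) := by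
      refine tendsto_const_nhds.congr' ?_
      filter_upwards [eventually_ge_atTop ⌈‖z t‖⌉₊] with N hN
      rw [indicator_of_mem (show t ∈ A N from Nat.ceil_le.1 hN)]
    exact this.liminf_eq.ge

/-- The supremum over square integrable fields of an integral functional is the integral of the
conjugate integrand. -/
lemma exists_integrable_conjugate (hL : IsASDLagrangian T L) {k : ℝ → ℝ}
    (hk : Integrable k (volume.restrict (Icc (0 : ℝ) T)))
    (hLk : ∀ᵐ t ∂(volume.restrict (Icc (0 : ℝ) T)), L t 0 0 ≤ k t) {q y : ℝ → H}
    (hq : MemLp q 2 (volume.restrict (Icc (0 : ℝ) T)))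
    (hy : MemLp y 2 (volume.restrict (Icc (0 : ℝ) T))) {c : ℝ}
    (h : ∀ x w : ℝ → H, MemLp x 2 (volume.restrict (Icc (0 : ℝ) T)) →
      MemLp w 2 (volume.restrict (Icc (0 : ℝ) T)) → ∀ g : ℝ → ℝ,
      Integrable g (volume.restrict (Icc (0 : ℝ) T)) →
      (∀ᵐ t ∂(volume.restrict (Icc (0 : ℝ) T)), L t (x t) (w t) ≤ g t) →
      (∫ t in Icc (0 : ℝ) T, (inner ℝ (q t) (x t) + inner ℝ (y t) (w t)))
        - ∫ t in Icc (0 : ℝ) T, g t ≤ c) :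
    ∃ g : ℝ → ℝ, Integrable g (volume.restrict (Icc (0 : ℝ) T)) ∧
      (∀ᵐ t ∂(volume.restrict (Icc (0 : ℝ) T)), L t (-y t) (-q t) ≤ g t) ∧
      ∫ t in Icc (0 : ℝ) T, g t ≤ c := by
  borelize H
  have hfin : ∀ᵐ t ∂(volume.restrict (Icc (0 : ℝ) T)), L t 0 0 ≠ ⊤ :=
    hLk.mono fun t ht => ne_top_of_le_ne_top (EReal.coe_ne_top _) ht
  have hex := fun n : ℕ => hL.exists_measurable_isProx hfin
    (show (0 : ℝ) < 1 / ((n : ℝ) + 1) by positivity) hq.1 hy.1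
  choose z hzm hz using hex
  let G : ℕ → ℝ → ENNReal := fun n t => ENNReal.ofReal (inner ℝ (q t) (z n t).1
    + inner ℝ (y t) (z n t).2 - (L t (z n t).1 (z n t).2).toReal + k t)
  have hz1 : ∀ n, AEStronglyMeasurable (fun t => (z n t).1) (volume.restrict (Icc (0 : ℝ) T)) :=
    fun n => (hzm n).fst.aestronglyMeasurable
  have hz2 : ∀ n, AEStronglyMeasurable (fun t => (z n t).2) (volume.restrict (Icc (0 : ℝ) T)) :=
    fun n => (hzm n).snd.aestronglyMeasurable
  have hG : ∀ n, AEMeasurable (G n) (volume.restrict (Icc (0 : ℝ) T)) := fun n =>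
    (((((hq.1.inner (hz1 n)).aemeasurable.add (hy.1.inner (hz2 n)).aemeasurable)).sub
      (hL.aemeasurable_comp (hz1 n) (hz2 n)).ereal_toReal).add
      hk.1.aemeasurable).ennreal_ofReal
  let M : ℝ → ENNReal := fun t => liminf (fun n => G n t) atTop
  have hM : AEMeasurable M (volume.restrict (Icc (0 : ℝ) T)) :=
    ⟨_, Measurable.liminf fun n => (hG n).measurable_mk, by
      filter_upwards [ae_all_iff.2 fun n => (hG n).ae_eq_mk] with t ht
      simp only [M, ht]⟩
  have hMc : ∫⁻ t in Icc (0 : ℝ) T, M t ≤ ENNReal.ofReal (c + ∫ t in Icc (0 : ℝ) T, k t) :=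
    lintegral_le_of_le_liminf hG (fun n => lintegral_isProx_le hL hk hLk hq hy h
      (by positivity) (hzm n).stronglyMeasurable (hz n)) (ae_of_all _ fun t => le_rfl)
  have hMtop : ∫⁻ t in Icc (0 : ℝ) T, M t ≠ ⊤ := ne_top_of_le_ne_top ENNReal.ofReal_ne_top hMc
  have hMi : Integrable (fun t => (M t).toReal) (volume.restrict (Icc (0 : ℝ) T)) :=
    integrable_toReal_of_lintegral_ne_top hM hMtop
  refine ⟨fun t => (M t).toReal - k t, hMi.sub hk, ?_, ?_⟩
  · filter_upwards [ae_all_iff.2 hz, ae_lt_top' hM hMtop, ae_restrict_mem measurableSet_Icc]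
      with t h1 h2 h3
    exact le_liminf_of_isProx (hL.lagrangian t h3) (hL.antiselfdual t h3) h1 h2.ne
  -- The zero field gives `c + ∫ k ≥ 0`, so `ENNReal.ofReal` truncates nothing in `hMc`.
  · have h0 := h 0 0 MemLp.zero MemLp.zero k hk (by simpa using hLk)
    simp only [Pi.zero_apply, inner_zero_right, add_zero, integral_zero, zero_sub] at h0
    rw [integral_sub hMi hk, integral_toReal hM (ae_lt_top' hM hMtop)]
    have := ENNReal.toReal_le_of_le_ofReal (by linarith) hMc
    linarith

end Interchange

/-! ### Separation: a linear form below a convex epigraph -/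

section Subgradient

/-- A convex set in `(X × Y) × ℝ` (the epigraph of a convex function that is nonnegative at the
origin and bounded near it) lies above a continuous linear form. -/
lemma exists_linear_minorant {X Y : Type*} [NormedAddCommGroup X] [InnerProductSpace ℝ X]
    [CompleteSpace X] [NormedAddCommGroup Y] [InnerProductSpace ℝ Y] [CompleteSpace Y]
    {E : Set ((X × Y) × ℝ)} (hE : Convex ℝ E) (h0 : ∀ r, ((0, 0), r) ∈ E → 0 ≤ r) {M : ℝ}
    (hM : 0 < M) (hint : ((0, 0), M) ∈ interior E) :
    ∃ (p : X) (b : Y), ∀ z ∈ E, inner ℝ p z.1.1 + inner ℝ b z.1.2 ≤ z.2 := by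
  have hnot : ((0, 0), (0 : ℝ)) ∉ interior E := by
    intro h
    have hc : Tendsto (fun r : ℝ => (((0 : X), (0 : Y)), r)) (𝓝[<] 0) (𝓝 ((0, 0), 0)) :=
      (by fun_prop : Continuous fun r : ℝ => (((0 : X), (0 : Y)), r)).continuousAt.mono_left
        nhdsWithin_le_nhds
    obtain ⟨r, h1, h2⟩ := ((hc.eventually (mem_interior_iff_mem_nhds.1 h)).and
      self_mem_nhdsWithin).exists
    exact absurd (h0 r h1) (not_le.2 h2)
  obtain ⟨F, hF⟩ := geometric_hahn_banach_open_point hE.interior isOpen_interior hnot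
  have hF0 : F ((0, 0), 0) = 0 := map_zero F
  rw [hF0] at hF
  -- A convex set with nonempty interior lies in the closure of its interior, so the inequality
  -- extends to all of `E`.
  have hle : ∀ z ∈ E, F z ≤ 0 := by
    intro z hz
    have h1 : z ∈ closure (interior E) := by
      rw [hE.closure_interior_eq_closure_of_nonempty_interior ⟨_, hint⟩]
      exact subset_closure hz
    exact closure_minimal (fun y hy => (hF y hy).le)
      (isClosed_le F.continuous continuous_const) h1
  have hdec : ∀ z : (X × Y) × ℝ, F z = F ((z.1.1, 0), 0) + F ((0, z.1.2), 0)
      + z.2 * F ((0, 0), 1) := by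
    intro z
    rw [← smul_eq_mul, ← map_smul, ← map_add, ← map_add]
    congr 1
    ext <;> simp
  set c := F ((0, 0), 1) with hc
  -- The separating hyperplane is not vertical: an interior point lies straight above the origin at
  -- height `M > 0`.
  have hcneg : c < 0 := by
    have h1 := hF _ hint
    rw [hdec] at h1
    simp only [show (((0 : X), (0 : Y)), (0 : ℝ)) = 0 from rfl, map_zero, zero_add] at h1
    exact neg_of_mul_neg_right h1 hM.le
  let F1 : StrongDual ℝ X := (F.comp (ContinuousLinearMap.inl ℝ (X × Y) ℝ)).comp
    (ContinuousLinearMap.inl ℝ X Y)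
  let F2 : StrongDual ℝ Y := (F.comp (ContinuousLinearMap.inl ℝ (X × Y) ℝ)).comp
    (ContinuousLinearMap.inr ℝ X Y)
  refine ⟨(-c)⁻¹ • (InnerProductSpace.toDual ℝ X).symm F1,
    (-c)⁻¹ • (InnerProductSpace.toDual ℝ Y).symm F2, fun z hz => ?_⟩
  rw [inner_smul_left, inner_smul_left, InnerProductSpace.toDual_symm_apply,
    InnerProductSpace.toDual_symm_apply]
  have h1 := hle z hz
  rw [hdec] at h1
  change F1 z.1.1 + F2 z.1.2 + z.2 * c ≤ 0 at h1
  simp only [conj_trivial]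
  rw [← mul_add, inv_mul_le_iff₀ (by linarith)]
  linarith

end Subgradient

/-! ### The lower bound for self-dual boundary Lagrangians -/

section Boundary

variable {H : Type*} [NormedAddCommGroup H] [InnerProductSpace ℝ H]

lemma IsConvexLagrangian.combo {f : H → H → EReal} (hf : IsConvexLagrangian f) {x p x' p' : H}
    {r r' : ℝ} (h : f x p ≤ r) (h' : f x' p' ≤ r') {a b : ℝ} (ha : 0 ≤ a) (hb : 0 ≤ b)
    (hab : a + b = 1) :
    f (a • x + b • x') (a • p + b • p') ≤ ((a * r + b * r' : ℝ) : EReal) :=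
  hf.convex_epigraph (x := ((x, p), r)) (y := ((x', p'), r')) h h' ha hb hab

/-- The point `(e, f)` itself is a competitor in the supremum defining `ℓ* (-e, f) = ℓ (e, f)`. -/
lemma IsSelfDualBoundary.le_of_le {l : H → H → EReal} (hl : IsSelfDualBoundary l) {e f : H}
    {s : ℝ} (h : l e f ≤ s) : (‖f‖ ^ 2 - ‖e‖ ^ 2) / 2 ≤ s := by
  have h1 := (le_legendre (-e) f h).trans_eq (hl.selfdual e f)
  have h2 := EReal.coe_le_coe_iff.1 (h1.trans h)
  rw [inner_neg_left, real_inner_self_eq_norm_sq, real_inner_self_eq_norm_sq] at h2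
  linarith

lemma IsSelfDualBoundary.le {l : H → H → EReal} (hl : IsSelfDualBoundary l) (e f : H) :
    (((‖f‖ ^ 2 - ‖e‖ ^ 2) / 2 : ℝ) : EReal) ≤ l e f := by
  rcases eq_or_ne (l e f) ⊤ with ht | ht
  · simp [ht]
  · have e1 := EReal.coe_toReal ht (hl.lagrangian.ne_bot e f)
    rw [← e1]
    exact EReal.coe_le_coe_iff.2 (hl.le_of_le e1.ge)

end Boundary

/-! ### The perturbed problem and existence of a zero of the action -/

section Existence

variable {H : Type*} [NormedAddCommGroup H] [InnerProductSpace ℝ H] [CompleteSpace H]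
  {T : ℝ} {L : ℝ → H → H → EReal} {l : H → H → EReal}

omit [CompleteSpace H] in
lemma IsASDLagrangian.neg_inner_le_ae (hL : IsASDLagrangian T L) (x w : ℝ → H) :
    ∀ᵐ t ∂(volume.restrict (Icc (0 : ℝ) T)),
      ((-inner ℝ (x t) (w t) : ℝ) : EReal) ≤ L t (x t) (w t) := by
  filter_upwards [ae_restrict_mem measurableSet_Icc] with t ht
  exact neg_inner_le_of_antiselfdual (hL.lagrangian t ht) (hL.antiselfdual t ht) _ _

lemma integral_Icc_inner_deriv (hT : 0 ≤ T) {u : ℝ → H} (hu : MemA2 T u) :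
    ∫ t in Icc (0 : ℝ) T, inner ℝ (u t) (deriv u t) = (‖u T‖ ^ 2 - ‖u 0‖ ^ 2) / 2 := by
  rw [integral_Icc_eq_integral_Ioc, ← intervalIntegral.integral_of_le hT,
    hu.integral_inner_deriv hT]

lemma IsASDLagrangian.le_extIntegral (hT : 0 ≤ T) (hL : IsASDLagrangian T L) {u : ℝ → H}
    (hu : MemA2 T u) : ((-((‖u T‖ ^ 2 - ‖u 0‖ ^ 2) / 2) : ℝ) : EReal)
      ≤ extIntegral T (fun t => L t (u t) (deriv u t)) := by
  rw [← integral_Icc_inner_deriv hT hu, ← integral_neg,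
    ← extIntegral_coe (g := fun t => -inner ℝ (u t) (deriv u t))
      (hu.integrable_inner_deriv hT).neg]
  exact extIntegral_mono (hL.neg_inner_le_ae u (deriv u))

lemma action_nonneg (hT : 0 ≤ T) (hL : IsASDLagrangian T L) (hl : IsSelfDualBoundary l)
    {u : ℝ → H} (hu : MemA2 T u) : 0 ≤ action T L l u := by
  have h := add_le_add (hL.le_extIntegral hT hu) (hl.le (u 0) (u T))
  rw [← EReal.coe_add, neg_add_cancel, EReal.coe_zero] at h
  exact h

/-- The epigraph of the value function of the perturbed minimization problem: the state is shifted
by `z.1.1` in the Lagrangian and by `z.1.2` in the first boundary argument. -/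
def perturbedEpigraph (T : ℝ) (L : ℝ → H → H → EReal) (l : H → H → EReal) :
    Set ((Lp H 2 (volume.restrict (Icc (0 : ℝ) T)) × H) × ℝ) :=
  {z | ∃ (a : H) (w : ℝ → H) (g : ℝ → ℝ) (s : ℝ),
    MemLp w 2 (volume.restrict (Icc (0 : ℝ) T)) ∧
    Integrable g (volume.restrict (Icc (0 : ℝ) T)) ∧
    (∀ᵐ t ∂(volume.restrict (Icc (0 : ℝ) T)), L t (z.1.1 t + primitive a w t) (w t) ≤ g t) ∧
    l (a + z.1.2) (primitive a w T) ≤ s ∧ (∫ t in Icc (0 : ℝ) T, g t) + s ≤ z.2}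

omit [CompleteSpace H] in
lemma convex_perturbedEpigraph (hT : 0 ≤ T) (hL : IsASDLagrangian T L)
    (hl : IsConvexLagrangian l) : Convex ℝ (perturbedEpigraph T L l) := by
  rintro z ⟨a, w, g, s, hw, hg, h1, h2, h3⟩ z' ⟨a', w', g', s', hw', hg', h1', h2', h3'⟩
    α β hα hβ hαβ
  have hprim : ∀ t ∈ Icc 0 T, primitive (α • a + β • a') (α • w + β • w') t
      = α • primitive a w t + β • primitive a' w' t := by
    intro t ht
    rw [primitive_add hT _ _ (intervalIntegrable_of_memLp hT (hw.const_smul α))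
      (intervalIntegrable_of_memLp hT (hw'.const_smul β)) ht, primitive_smul, primitive_smul]
  refine ⟨α • a + β • a', α • w + β • w', fun t => α * g t + β * g' t, α * s + β * s',
    (hw.const_smul α).add (hw'.const_smul β), (hg.const_mul α).add (hg'.const_mul β), ?_, ?_, ?_⟩
  · filter_upwards [h1, h1', ae_restrict_mem measurableSet_Icc,
      Lp.coeFn_add (α • z.1.1) (β • z'.1.1), Lp.coeFn_smul α z.1.1, Lp.coeFn_smul β z'.1.1]
      with t e1 e2 e3 e4 e5 e6
    have := (hL.lagrangian t e3).combo e1 e2 hα hβ hαβ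
    rw [hprim t e3]
    simp only [Prod.fst_add, Prod.smul_fst, e4, Pi.add_apply, e5, e6, Pi.smul_apply]
    convert this using 1
    congr 1
    module
  · have := hl.combo h2 h2' hα hβ hαβ
    rw [hprim T ⟨hT, le_rfl⟩]
    simp only [Prod.fst_add, Prod.snd_add, Prod.smul_fst, Prod.smul_snd]
    convert this using 2
    module
  · rw [integral_add (hg.const_mul α) (hg'.const_mul β), integral_const_mul, integral_const_mul]
    simp only [Prod.snd_add, Prod.smul_snd, smul_eq_mul]
    nlinarith [mul_le_mul_of_nonneg_left h3 hα, mul_le_mul_of_nonneg_left h3' hβ]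

/-- Without perturbation, the lower bounds of `L` and `ℓ` cancel by the energy identity. -/
lemma nonneg_of_mem_perturbedEpigraph (hT : 0 ≤ T) (hL : IsASDLagrangian T L)
    (hl : IsSelfDualBoundary l) {r : ℝ} (h : ((0, 0), r) ∈ perturbedEpigraph T L l) : 0 ≤ r := by
  obtain ⟨a, w, g, s, hw, hg, h1, h2, h3⟩ := h
  have hwi := intervalIntegrable_of_memLp hT hw
  have h4 := hl.le_of_le h2
  have h5 := integral_inner_primitive_self hT a hwi
  have h6 := intervalIntegrable_inner_continuousOn hT (continuousOn_primitive hT a hwi) hwi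
  rw [intervalIntegrable_iff_integrableOn_Icc_of_le hT] at h6
  rw [intervalIntegral.integral_of_le hT, ← integral_Icc_eq_integral_Ioc] at h5
  have h7 : ∫ t in Icc (0 : ℝ) T, -inner ℝ (primitive a w t) (w t)
      ≤ ∫ t in Icc (0 : ℝ) T, g t := by
    refine integral_mono_ae h6.neg hg ?_
    filter_upwards [h1, hL.neg_inner_le_ae (primitive a w) w, Lp.coeFn_zero H 2
      (volume.restrict (Icc (0 : ℝ) T))] with t e1 e2 e3
    simp only [e3, Pi.zero_apply, zero_add] at e1
    exact EReal.coe_le_coe_iff.1 (e2.trans e1)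
  rw [integral_neg, h5] at h7
  simp only [add_zero] at h4 h3
  linarith

variable [SecondCountableTopology H]

omit [CompleteSpace H] in
-- Since `L (t, x, 0) ≥ -⟨x, 0⟩ = 0`, a finite bound on the extended integral gives genuine
-- integrability.
lemma integrable_toReal_lagrangian_zero (hL : IsASDLagrangian T L) {x : ℝ → H}
    (hx : MemLp x 2 (volume.restrict (Icc (0 : ℝ) T))) {c : ℝ}
    (hc : extIntegral T (fun t => L t (x t) 0) ≤ c) :
    (∀ᵐ t ∂(volume.restrict (Icc (0 : ℝ) T)), L t (x t) 0 ≤ ((L t (x t) 0).toReal : EReal)) ∧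
    Integrable (fun t => (L t (x t) 0).toReal) (volume.restrict (Icc (0 : ℝ) T)) ∧
    ∫ t in Icc (0 : ℝ) T, (L t (x t) 0).toReal ≤ c := by
  borelize H
  obtain ⟨h1, h2, h3⟩ := integrable_toReal_of_extIntegral_le (g := fun _ => 0)
    (hL.aemeasurable_comp hx.1 aestronglyMeasurable_const) (integrable_zero _ _ _)
    ((hL.neg_inner_le_ae x fun _ => 0).mono fun t ht => by simpa using ht) hc
  refine ⟨h1.mono fun t ht => ht.le, h2, ?_⟩
  rw [h3] at hc
  exact EReal.coe_le_coe_iff.1 hc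

omit [CompleteSpace H] in
-- The zero arc is the competitor: it bounds the value function near the origin by `C (1 + ‖y‖²) +
-- K`, which is continuous in the perturbation `y`.
lemma mem_interior_perturbedEpigraph (hL : IsASDLagrangian T L) {C : ℝ}
    (hbound : ∀ x : ℝ → H, MemLp x 2 (volume.restrict (Icc (0 : ℝ) T)) →
      extIntegral T (fun t => L t (x t) 0)
        ≤ ((C * (1 + ∫ t in Icc (0 : ℝ) T, ‖x t‖ ^ 2) : ℝ) : EReal))
    {ε K : ℝ} (hε : 0 < ε) (hK : ∀ a : H, ‖a‖ < ε → l a 0 ≤ K) {M : ℝ} (hM : C + K < M) :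
    ((0, 0), M) ∈ interior (perturbedEpigraph T L l) := by
  refine interior_maximal (s := perturbedEpigraph T L l)
    (t := {z | ‖z.1.2‖ < ε ∧ C * (1 + ‖z.1.1‖ ^ 2) + K < z.2}) ?_ ?_ ?_
  · rintro z ⟨h1, h2⟩
    have hz := Lp.memLp z.1.1
    obtain ⟨e1, e2, e3⟩ := integrable_toReal_lagrangian_zero hL hz (hbound _ hz)
    refine ⟨0, 0, _, K, MemLp.zero, e2, ?_, ?_, ?_⟩
    · filter_upwards [e1] with t ht
      simpa [primitive] using ht
    · simpa [primitive] using hK z.1.2 h1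
    · have h3 : ‖z.1.1‖ ^ 2 = ∫ t in Icc (0 : ℝ) T, ‖z.1.1 t‖ ^ 2 := by
        rw [← real_inner_self_eq_norm_sq, L2.inner_def]
        simp only [real_inner_self_eq_norm_sq]
      rw [h3] at h2
      linarith
  · have c1 : Continuous fun z : (Lp H 2 (volume.restrict (Icc (0 : ℝ) T)) × H) × ℝ => ‖z.1.2‖ := by
      fun_prop
    have c2 : Continuous fun z : (Lp H 2 (volume.restrict (Icc (0 : ℝ) T)) × H) × ℝ =>
        C * (1 + ‖z.1.1‖ ^ 2) + K := by fun_prop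
    exact (isOpen_lt c1 continuous_const).inter (isOpen_lt c2 continuous_snd)
  · simpa [hε] using hM

omit [SecondCountableTopology H] in
/-- A linear minorant of the value function is a dual arc: integrating by parts decouples the
boundary terms from the Lagrangian. -/
lemma legendre_boundary_le (hT : 0 ≤ T) (hl : ∀ x p, l x p ≠ ⊥)
    {p : Lp H 2 (volume.restrict (Icc (0 : ℝ) T))} {b : H}
    (hpb : ∀ z ∈ perturbedEpigraph T L l, inner ℝ p z.1.1 + inner ℝ b z.1.2 ≤ z.2)
    {x w : ℝ → H} (hx : MemLp x 2 (volume.restrict (Icc (0 : ℝ) T)))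
    (hw : MemLp w 2 (volume.restrict (Icc (0 : ℝ) T))) {g : ℝ → ℝ}
    (hg : Integrable g (volume.restrict (Icc (0 : ℝ) T)))
    (hLg : ∀ᵐ t ∂(volume.restrict (Icc (0 : ℝ) T)), L t (x t) (w t) ≤ g t) :
    legendre l b (-primitive b p T) ≤ (((∫ t in Icc (0 : ℝ) T, g t)
      - ∫ t in Icc (0 : ℝ) T, (inner ℝ (p t) (x t) + inner ℝ (primitive b p t) (w t)) : ℝ) :
        EReal) := by
  have hp := Lp.memLp p
  have hpi := intervalIntegrable_of_memLp hT hp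
  have hvL : MemLp (primitive b p) 2 (volume.restrict (Icc (0 : ℝ) T)) :=
    memLp_of_continuousOn (continuousOn_primitive hT b hpi)
  refine legendre_le (fun e f s hs => ?_) hl
  have hwi := intervalIntegrable_of_memLp hT hw
  -- The initial point is chosen so that the arc with velocity `w` ends at `f`; the perturbation `(x
  -- - u, e - a)` then makes `x` and `e` arbitrary.
  set a : H := f - ∫ t in (0 : ℝ)..T, w t with ha
  have haT : primitive a w T = f := by simp [primitive, ha]
  have huc := continuousOn_primitive hT a hwi
  have huL := memLp_of_continuousOn huc
  have hy := hx.sub huL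
  have h1 := hpb ((hy.toLp _, e - a), (∫ t in Icc (0 : ℝ) T, g t) + s)
    ⟨a, w, g, s, hw, hg, by
      filter_upwards [hLg, hy.coeFn_toLp] with t e1 e2
      simpa [e2] using e1, by simpa [haT] using hs, le_rfl⟩
  have h2 : inner ℝ p (hy.toLp _) = (∫ t in Icc (0 : ℝ) T, inner ℝ (p t) (x t))
      - ∫ t in Icc (0 : ℝ) T, inner ℝ (p t) (primitive a w t) := by
    rw [L2.inner_def, ← integral_sub (integrable_inner_of_memLp hp hx)
      (integrable_inner_of_memLp hp huL)]
    refine integral_congr_ae ?_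
    filter_upwards [hy.coeFn_toLp] with t e2
    rw [e2, Pi.sub_apply, inner_sub_right]
  have h3 := integral_inner_primitive_add hT a b hwi hpi
  rw [intervalIntegral.integral_of_le hT, ← integral_Icc_eq_integral_Ioc,
    integral_add (integrable_inner_of_memLp hp huL) (integrable_inner_of_memLp hvL hw),
    haT] at h3
  rw [integral_add (integrable_inner_of_memLp hp hx) (integrable_inner_of_memLp hvL hw)]
  simp only [h2, inner_sub_right] at h1
  rw [inner_neg_left]
  linarith

/-- The variational principle: the action attains the value `0`. -/
theorem exists_action_eq_zero (hT : 0 ≤ T) (hL : IsASDLagrangian T L) {C : ℝ}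
    (hbound : ∀ x : ℝ → H, MemLp x 2 (volume.restrict (Icc (0 : ℝ) T)) →
      extIntegral T (fun t => L t (x t) 0)
        ≤ ((C * (1 + ∫ t in Icc (0 : ℝ) T, ‖x t‖ ^ 2) : ℝ) : EReal))
    (hl : IsSelfDualBoundary l) {ε K : ℝ} (hε : 0 < ε) (hK : ∀ a : H, ‖a‖ < ε → l a 0 ≤ K) :
    ∃ v : ℝ → H, MemA2 T v ∧
      (∀ᵐ t ∂(volume.restrict (Icc (0 : ℝ) T)), L t (v t) (deriv v t) < ⊤) ∧
      action T L l v = 0 := by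
  have hint : ((0, 0), |C + K| + 1) ∈ interior (perturbedEpigraph T L l) :=
    mem_interior_perturbedEpigraph hL hbound hε hK (by linarith [le_abs_self (C + K)])
  have h0 : ∀ r, ((0, 0), r) ∈ perturbedEpigraph T L l → 0 ≤ r :=
    fun r => nonneg_of_mem_perturbedEpigraph hT hL hl
  obtain ⟨p, b, hpb⟩ := exists_linear_minorant
    (X := Lp H 2 (volume.restrict (Icc (0 : ℝ) T))) (Y := H) (E := perturbedEpigraph T L l)
    (convex_perturbedEpigraph hT hL hl.lagrangian) h0 (M := |C + K| + 1) (by positivity) hint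
  have hp := Lp.memLp p
  have hpi := intervalIntegrable_of_memLp hT hp
  set v : ℝ → H := primitive b p with hv
  have hvA : MemA2 T v := memA2_primitive hT b hp
  have hvL : MemLp v 2 (volume.restrict (Icc (0 : ℝ) T)) :=
    memLp_of_continuousOn (continuousOn_primitive hT b hpi)
  have key : ∀ x w : ℝ → H, MemLp x 2 (volume.restrict (Icc (0 : ℝ) T)) →
      MemLp w 2 (volume.restrict (Icc (0 : ℝ) T)) → ∀ g : ℝ → ℝ,
      Integrable g (volume.restrict (Icc (0 : ℝ) T)) →
      (∀ᵐ t ∂(volume.restrict (Icc (0 : ℝ) T)), L t (x t) (w t) ≤ g t) →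
      legendre l b (-v T) ≤ (((∫ t in Icc (0 : ℝ) T, g t)
        - ∫ t in Icc (0 : ℝ) T, (inner ℝ (p t) (x t) + inner ℝ (v t) (w t)) : ℝ) : EReal) :=
    fun x w hx hw g hg hLg => legendre_boundary_le hT hl.lagrangian.ne_bot hpb hx hw hg hLg
  obtain ⟨k1, k2, -⟩ := integrable_toReal_lagrangian_zero hL (x := 0) MemLp.zero
    (hbound 0 MemLp.zero)
  simp only [Pi.zero_apply] at k1 k2
  have hself : legendre l b (-v T) = l (-b) (-v T) := by
    simpa using hl.selfdual (-b) (-v T)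
  rw [hself] at key
  -- Zero fields already bound the boundary term from above.
  have hfin : l (-b) (-v T) ≠ ⊤ := ne_top_of_le_ne_top (EReal.coe_ne_top _)
    (key 0 0 MemLp.zero MemLp.zero _ k2 (by simpa using k1))
  have hcoe := EReal.coe_toReal hfin (hl.lagrangian.ne_bot _ _)
  rw [← hcoe] at key
  -- The conjugate at `(p, v)` is `L (t, -v, -p)`, the Lagrangian along the arc `-v`.
  obtain ⟨g, hg, hLg, hgc⟩ := exists_integrable_conjugate hL k2 k1 hp hvL
    (c := -(l (-b) (-v T)).toReal) (fun x w hx hw g hg hLg => by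
      have := EReal.coe_le_coe_iff.1 (key x w hx hw g hg hLg)
      linarith)
  have hLg' : ∀ᵐ t ∂(volume.restrict (Icc (0 : ℝ) T)),
      L t (-v t) (deriv (fun t => -v t) t) ≤ g t := by
    filter_upwards [hLg, deriv_primitive_ae hT b hp] with t e1 e2
    rwa [deriv.fun_neg, e2]
  refine ⟨fun t => -v t, hvA.neg, hLg'.mono fun t ht => ht.trans_lt (EReal.coe_lt_top _), ?_⟩
  refine le_antisymm ?_ (action_nonneg hT hL hl hvA.neg)
  have h1 := extIntegral_mono hLg'
  rw [extIntegral_coe hg] at h1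
  have h2 : l (-v 0) (-v T) = ((l (-b) (-v T)).toReal : EReal) := by
    rw [hcoe, hv, primitive_zero]
  refine (add_le_add h1 h2.le).trans ?_
  rw [← EReal.coe_add]
  exact EReal.coe_nonpos.2 (by linarith)

end Existence

/-! ### The boundary Lagrangian of the initial condition -/

section InitialBoundary

variable {H : Type*} [NormedAddCommGroup H] [InnerProductSpace ℝ H]

lemma isConvexLagrangian_initialBoundary (v₀ : H) : IsConvexLagrangian (initialBoundary v₀) where
  ne_bot x p := EReal.coe_ne_bot _
  proper := ⟨0, 0, EReal.coe_ne_top _⟩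
  lsc := by
    refine Continuous.lowerSemicontinuous (continuous_coe_real_ereal.comp ?_)
    fun_prop
  convex_epigraph := by
    rintro ⟨⟨x, p⟩, r⟩ h ⟨⟨x', p'⟩, r'⟩ h' a b ha hb hab
    have key : ∀ y z : H, ‖a • y + b • z‖ ^ 2 ≤ a * ‖y‖ ^ 2 + b * ‖z‖ ^ 2 := by
      intro y z
      have h1 : 0 ≤ a * b * ‖y - z‖ ^ 2 := by positivity
      rw [norm_sub_sq_real] at h1
      rw [norm_add_sq_real, norm_smul, norm_smul, mul_pow, mul_pow, inner_smul_left,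
        inner_smul_right, Real.norm_eq_abs, Real.norm_eq_abs, sq_abs, sq_abs]
      obtain rfl : b = 1 - a := by linarith
      simp only [conj_trivial]
      nlinarith
    have h1 := mul_le_mul_of_nonneg_left (EReal.coe_le_coe_iff.1 h) ha
    have h2 := mul_le_mul_of_nonneg_left (EReal.coe_le_coe_iff.1 h') hb
    refine EReal.coe_le_coe_iff.2 ?_
    simp only [Prod.fst_add, Prod.snd_add, Prod.smul_fst, Prod.smul_snd, smul_eq_mul,
      inner_add_right, inner_smul_right] at h1 h2 ⊢
    have h3 : ‖v₀‖ ^ 2 = a * ‖v₀‖ ^ 2 + b * ‖v₀‖ ^ 2 := by rw [← add_mul, hab, one_mul]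
    linarith [key x x', key p p']

/-- The conjugate is a supremum of a concave quadratic, attained at `x = 2 v₀ - h₁`, `p = h₂`;
completing squares there gives both inequalities. -/
lemma isSelfDualBoundary_initialBoundary (v₀ : H) : IsSelfDualBoundary (initialBoundary v₀) where
  lagrangian := isConvexLagrangian_initialBoundary v₀
  selfdual h₁ h₂ := by
    refine le_antisymm (legendre_le (fun x p r h => ?_)
      (isConvexLagrangian_initialBoundary v₀).ne_bot) ?_
    · have h1 := EReal.coe_le_coe_iff.1 h
      have h2 : 0 ≤ ‖x - ((2 : ℝ) • v₀ - h₁)‖ ^ 2 := by positivity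
      have h3 : 0 ≤ ‖p - h₂‖ ^ 2 := by positivity
      rw [norm_sub_sq_real, norm_sub_sq_real, norm_smul, inner_sub_right, inner_smul_right,
        inner_smul_left, mul_pow] at h2
      rw [norm_sub_sq_real] at h3
      simp only [conj_trivial, Real.norm_ofNat] at h2
      rw [inner_neg_left]
      rw [real_inner_comm] at h2 h3
      rw [real_inner_comm h₁ x] at h2
      linarith
    · refine le_trans (EReal.coe_le_coe_iff.2 ?_)
        (le_legendre (-h₁) h₂ (x := (2 : ℝ) • v₀ - h₁) (p := h₂) le_rfl)
      rw [norm_sub_sq_real, norm_smul, inner_sub_right, inner_sub_right, inner_smul_right,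
        inner_smul_right, inner_smul_left, mul_pow, inner_neg_left, inner_neg_left,
        real_inner_self_eq_norm_sq, real_inner_self_eq_norm_sq, real_inner_self_eq_norm_sq,
        real_inner_comm v₀ h₁]
      simp only [conj_trivial, Real.norm_ofNat]
      linarith

lemma initialBoundary_zero_le (v₀ : H) {a : H} (ha : ‖a‖ < 1) :
    initialBoundary v₀ a 0 ≤ ((1 / 2 + 2 * ‖v₀‖ + ‖v₀‖ ^ 2 : ℝ) : EReal) := by
  refine EReal.coe_le_coe_iff.2 ?_
  have h1 := neg_le_of_abs_le (abs_real_inner_le_norm v₀ a)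
  have h2 : ‖v₀‖ * ‖a‖ ≤ ‖v₀‖ * 1 := by gcongr
  have h3 : ‖a‖ ^ 2 ≤ 1 := by nlinarith [norm_nonneg a]
  rw [norm_zero]
  linarith

end InitialBoundary

/-! ### Extremal arcs: equality in Fenchel's inequality and dissipativity -/

section Extremal

variable {H : Type*} [NormedAddCommGroup H] [InnerProductSpace ℝ H] {f : H → H → EReal}

lemma mem_subdiff₂_of_eq_neg_inner (hf : IsConvexLagrangian f)
    (ha : ∀ p x : H, legendre f p x = f (-x) (-p)) {x p : H}
    (h : f x p = ((-inner ℝ x p : ℝ) : EReal)) : (-p, -x) ∈ subdiff₂ f x p := by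
  refine ⟨by rw [h]; exact EReal.coe_ne_top _, fun x' p' => ?_⟩
  rcases eq_or_ne (f x' p') ⊤ with ht | ht
  · simp [ht]
  · have e := EReal.coe_toReal ht (hf.ne_bot x' p')
    have := fenchel_of_antiselfdual ha h.le e.ge
    rw [h, ← e, ← EReal.coe_add]
    refine EReal.coe_le_coe_iff.2 ?_
    simp only [inner_neg_left, inner_sub_right, real_inner_comm x p, real_inner_comm x' p] at this ⊢
    linarith

/-- Fenchel's inequality between two extremal points: the equation satisfied by `v` is governed by a
dissipative relation. -/
lemma inner_sub_sub_nonpos (ha : ∀ p x : H, legendre f p x = f (-x) (-p)) {x p x' p' : H}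
    (h : f x p = ((-inner ℝ x p : ℝ) : EReal)) (h' : f x' p' = ((-inner ℝ x' p' : ℝ) : EReal)) :
    inner ℝ (x - x') (p - p') ≤ 0 := by
  have := fenchel_of_antiselfdual ha h.le h'.le
  simp only [inner_sub_left, inner_sub_right]
  linarith

lemma subdiff_of_mem_subdiff₂ {x p q y : H} (h : (q, y) ∈ subdiff₂ f x p) :
    y ∈ subdiff (fun p => f x p) p ∧ q ∈ subdiff (fun x => f x p) x :=
  ⟨⟨h.1, fun p' => by simpa using h.2 x p'⟩, ⟨h.1, fun x' => by simpa using h.2 x' p⟩⟩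

variable [CompleteSpace H] [SecondCountableTopology H] {T : ℝ} {L : ℝ → H → H → EReal}

/-- An arc at which the action with initial condition `v₀` vanishes starts at `v₀`, and its
Lagrangian equals its lower bound almost everywhere. -/
lemma eq_neg_inner_of_action_eq_zero (hT : 0 ≤ T) (hL : IsASDLagrangian T L) {v₀ : H} {u : ℝ → H}
    (hu : MemA2 T u) (h : action T L (initialBoundary v₀) u = 0) :
    u 0 = v₀ ∧ ∀ᵐ t ∂(volume.restrict (Icc (0 : ℝ) T)),
      L t (u t) (deriv u t) = ((-inner ℝ (u t) (deriv u t) : ℝ) : EReal) := by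
  borelize H
  set r : ℝ := 1 / 2 * ‖u 0‖ ^ 2 - 2 * inner ℝ v₀ (u 0) + ‖v₀‖ ^ 2 + 1 / 2 * ‖u T‖ ^ 2 with hr
  have h1 : extIntegral T (fun t => L t (u t) (deriv u t)) = ((-r : ℝ) : EReal) := by
    have h2 : extIntegral T (fun t => L t (u t) (deriv u t)) + (r : EReal) = 0 := h
    generalize extIntegral T (fun t => L t (u t) (deriv u t)) = Y at h2 ⊢
    induction Y with
    | bot => simp at h2
    | top => simp at h2
    | coe X =>
      rw [← EReal.coe_add] at h2
      have h3 : X + r = 0 := by exact_mod_cast h2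
      rw [show X = -r by linarith]
  have hi := hu.integrable_inner_deriv hT
  obtain ⟨e1, e2, e3⟩ := integrable_toReal_of_extIntegral_le
    (g := fun t => -inner ℝ (u t) (deriv u t))
    (hL.aemeasurable_comp (memLp_of_continuousOn (hu.continuousOn hT)).1 hu.memLp_deriv.1)
    hi.neg (hL.neg_inner_le_ae u (deriv u)) h1.le
  rw [h1] at e3
  have e4 := EReal.coe_eq_coe_iff.1 e3
  have hnn : ∀ᵐ t ∂(volume.restrict (Icc (0 : ℝ) T)),
      0 ≤ (L t (u t) (deriv u t)).toReal + inner ℝ (u t) (deriv u t) := by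
    filter_upwards [e1, hL.neg_inner_le_ae u (deriv u)] with t h2 h3
    rw [h2] at h3
    linarith [EReal.coe_le_coe_iff.1 h3]
  -- The boundary term exceeds `(‖u(T)‖² - ‖u(0)‖²) / 2` by exactly `‖u(0) - v₀‖²`, so a nonnegative
  -- integral equals minus a square.
  have hsum : ∫ t in Icc (0 : ℝ) T, ((L t (u t) (deriv u t)).toReal + inner ℝ (u t) (deriv u t))
      = -‖u 0 - v₀‖ ^ 2 := by
    rw [integral_add e2 hi, ← e4, integral_Icc_inner_deriv hT hu, norm_sub_sq_real, hr,
      real_inner_comm]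
    ring
  have hge := integral_nonneg_of_ae hnn
  rw [hsum] at hge
  have h0 : ‖u 0 - v₀‖ = 0 := by nlinarith [sq_nonneg ‖u 0 - v₀‖]
  refine ⟨sub_eq_zero.1 (norm_eq_zero.1 h0), ?_⟩
  rw [h0] at hsum
  have hz := (integral_eq_zero_iff_of_nonneg_ae hnn (e2.add hi)).1 (by simpa using hsum)
  filter_upwards [e1, hz] with t h2 h3
  rw [h2]
  simp only [Pi.zero_apply] at h3
  exact EReal.coe_eq_coe_iff.2 (by linarith)

omit [SecondCountableTopology H] in
/-- A dissipative arc ends no farther from the origin than it starts. -/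
lemma norm_primitive_le {a : H} {w : ℝ → H} (hT : 0 ≤ T) (hw : IntervalIntegrable w volume 0 T)
    (h : ∀ᵐ t ∂(volume.restrict (Icc (0 : ℝ) T)), inner ℝ (primitive a w t) (w t) ≤ 0) :
    ‖primitive a w T‖ ≤ ‖a‖ := by
  have h1 := integral_inner_primitive_self hT a hw
  rw [intervalIntegral.integral_of_le hT, ← integral_Icc_eq_integral_Ioc] at h1
  have h2 := integral_nonpos_of_ae h
  rw [h1] at h2
  exact (sq_le_sq₀ (norm_nonneg _) (norm_nonneg _)).1 (by linarith)

omit [SecondCountableTopology H] in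
-- On each `[0, t]` the difference `u - v` is a dissipative arc starting at `0`.
lemma eqOn_of_dissipative {u v : ℝ → H} (hu : MemA2 T u) (hv : MemA2 T v) (h0 : u 0 = v 0)
    (h : ∀ᵐ t ∂(volume.restrict (Icc (0 : ℝ) T)), inner ℝ (u t - v t) (deriv u t - deriv v t) ≤ 0) :
    EqOn u v (Icc 0 T) := by
  intro t ht
  have hu' := (hu.mono ht.2).intervalIntegrable ht.1
  have hv' := (hv.mono ht.2).intervalIntegrable ht.1
  have hd : ∀ s ∈ Icc 0 t, primitive (u 0 + -v 0) (deriv u + -deriv v) s = u s - v s := by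
    intro s hs
    rw [primitive_add ht.1 _ _ hu' hv'.neg hs, primitive_neg,
      ← (hu.mono ht.2).eq_primitive hs, ← (hv.mono ht.2).eq_primitive hs, sub_eq_add_neg]
  have h1 := norm_primitive_le (a := u 0 + -v 0) (w := deriv u + -deriv v) ht.1
    (hu'.add hv'.neg) (by
    filter_upwards [ae_restrict_of_ae_restrict_of_subset (Icc_subset_Icc_right ht.2) h,
      ae_restrict_mem measurableSet_Icc] with s h1 h2
    rw [hd s h2, Pi.add_apply, Pi.neg_apply, ← sub_eq_add_neg]
    exact h1)
  rw [hd t ⟨ht.1, le_rfl⟩, h0, add_neg_cancel, norm_zero] at h1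
  exact sub_eq_zero.1 (norm_le_zero_iff.1 h1)

omit [SecondCountableTopology H] in
/-- The autonomous flow is nonexpansive along translations of a trajectory. -/
lemma norm_translate_sub_le {v : ℝ → H} (hv : MemA2 T v) {S : Set ℝ}
    (hS : ∀ᵐ t ∂(volume.restrict (Icc (0 : ℝ) T)), t ∈ S)
    (hmono : ∀ s ∈ S, ∀ t ∈ S, inner ℝ (v s - v t) (deriv v s - deriv v t) ≤ 0)
    {s h : ℝ} (hs : 0 ≤ s) (hh : 0 ≤ h) (hsh : s + h ≤ T) :
    ‖v (s + h) - v s‖ ≤ ‖v h - v 0‖ := by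
  have hT : 0 ≤ T := by linarith
  have hi := hv.intervalIntegrable hT
  have h1 : IntervalIntegrable (fun r => deriv v (r + h)) volume 0 s := by
    have : IntervalIntegrable (deriv v) volume h (s + h) := hi.mono_set (by
      rw [uIcc_of_le hT, uIcc_of_le (by linarith)]
      exact Icc_subset_Icc hh hsh)
    simpa using this.comp_add_right h
  have h2 : IntervalIntegrable (deriv v) volume 0 s := hi.mono_set (by
    rw [uIcc_of_le hT, uIcc_of_le hs]
    exact Icc_subset_Icc_right (by linarith))
  have hshift : ∀ r ∈ Icc 0 s, primitive (v h) (fun r => deriv v (r + h)) r = v (r + h) := by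
    intro r hr
    have e := primitive_sub hT (v 0) hi (s := h) (t := r + h) ⟨hh, by linarith [hs]⟩
      ⟨by linarith [hr.1], by linarith [hr.2]⟩
    rw [← hv.eq_primitive ⟨hh, by linarith⟩,
      ← hv.eq_primitive ⟨by linarith [hr.1], by linarith [hr.2]⟩] at e
    rw [primitive, intervalIntegral.integral_comp_add_right, zero_add, ← e]
    abel
  have hd : ∀ r ∈ Icc 0 s, primitive (v h + -v 0) ((fun r => deriv v (r + h)) + -deriv v) r
      = v (r + h) - v r := by
    intro r hr
    rw [primitive_add hs _ _ h1 h2.neg hr, primitive_neg, hshift r hr,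
      ← hv.eq_primitive ⟨hr.1, by linarith [hr.2]⟩, sub_eq_add_neg]
  have hS' := (ae_restrict_iff' measurableSet_Icc).1 hS
  have hS'' : ∀ᵐ r ∂(volume : Measure ℝ), r + h ∈ Icc 0 T → r + h ∈ S :=
    (measurePreserving_add_right volume h).quasiMeasurePreserving.ae hS'
  have key := norm_primitive_le (a := v h + -v 0) (w := (fun r => deriv v (r + h)) + -deriv v) hs
    (h1.add h2.neg) (by
      rw [ae_restrict_iff' measurableSet_Icc]
      filter_upwards [hS', hS''] with r e1 e2 hr
      rw [hd r hr, Pi.add_apply, Pi.neg_apply, ← sub_eq_add_neg]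
      exact hmono _ (e2 ⟨by linarith [hr.1], by linarith [hr.2]⟩) _
        (e1 ⟨hr.1, by linarith [hr.2]⟩))
  rwa [hd s ⟨hs, le_rfl⟩, ← sub_eq_add_neg] at key

omit [CompleteSpace H] [SecondCountableTopology H] in
-- The backward difference quotient at `t > 0` with step `r` is compared with the forward one at
-- `0`; backward steps also cover `t = T`.
lemma norm_derivWithin_le_of_translate {v : ℝ → H} (hT : 0 < T)
    (hv : DifferentiableOn ℝ v (Icc 0 T))
    (h : ∀ s h : ℝ, 0 ≤ s → 0 ≤ h → s + h ≤ T → ‖v (s + h) - v s‖ ≤ ‖v h - v 0‖) {t : ℝ}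
    (ht : t ∈ Icc 0 T) :
    ‖derivWithin v (Icc 0 T) t‖ ≤ ‖derivWithin v (Icc 0 T) 0‖ := by
  rcases ht.1.eq_or_lt with rfl | ht0
  · exact le_rfl
  have d1 := (hasDerivWithinAt_iff_tendsto_slope.1 (hv t ht).hasDerivWithinAt).norm
  have d2 := (hasDerivWithinAt_iff_tendsto_slope.1 (hv 0 ⟨le_rfl, hT.le⟩).hasDerivWithinAt).norm
  have l1 : Tendsto (fun r : ℝ => t - r) (𝓝[>] 0) (𝓝[Icc 0 T \ {t}] t) := by
    refine tendsto_nhdsWithin_iff.2 ⟨?_, ?_⟩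
    · have : Tendsto (fun r : ℝ => t - r) (𝓝 0) (𝓝 (t - 0)) :=
        (continuous_const.sub continuous_id).tendsto 0
      rw [sub_zero] at this
      exact this.mono_left nhdsWithin_le_nhds
    · filter_upwards [Ioc_mem_nhdsGT ht0] with r hr
      exact ⟨⟨by linarith [hr.2], by linarith [hr.1, ht.2]⟩, by simpa using hr.1.ne'⟩
  have l2 : Tendsto (fun r : ℝ => r) (𝓝[>] 0) (𝓝[Icc 0 T \ {0}] 0) := by
    refine tendsto_nhdsWithin_iff.2 ⟨tendsto_id.mono_left nhdsWithin_le_nhds, ?_⟩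
    filter_upwards [Ioc_mem_nhdsGT hT] with r hr
    exact ⟨⟨hr.1.le, hr.2⟩, by simpa using hr.1.ne'⟩
  refine le_of_tendsto_of_tendsto (d1.comp l1) (d2.comp l2) ?_
  filter_upwards [Ioc_mem_nhdsGT ht0] with r hr
  have := h (t - r) r (by linarith [hr.2]) hr.1.le (by linarith [ht.2])
  rw [sub_add_cancel] at this
  simp only [Function.comp_apply, slope, vsub_eq_sub, norm_smul, sub_sub_cancel_left, sub_zero,
    norm_inv, norm_neg]
  rw [norm_sub_rev (v (t - r))]
  gcongr

end Extremal

end ASD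

end

/-! ### The variational principle and the initial-value problem -/

theorem theorem6p2 {H : Type*} [NormedAddCommGroup H] [InnerProductSpace ℝ H] [CompleteSpace H]
    [TopologicalSpace.SeparableSpace H] (T : ℝ) (hT : 0 < T)
    (L : ℝ → H → H → EReal) (hL : ASD.IsASDLagrangian T L)
    (C : ℝ) (hC : 0 < C)
    (hbound : ∀ x : ℝ → H, MemLp x 2 (volume.restrict (Icc (0 : ℝ) T)) →
      ASD.extIntegral T (fun t => L t (x t) 0)
        ≤ ((C * (1 + ∫ t in Icc (0 : ℝ) T, ‖x t‖ ^ 2) : ℝ) : EReal)) :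
    -- general self-dual boundary Lagrangians, with `ℓ (·, 0)` bounded above near the origin
    (∀ l : H → H → EReal, ASD.IsSelfDualBoundary l →
      (∃ ε > (0 : ℝ), ∃ K : ℝ, ∀ a : H, ‖a‖ < ε → l a 0 ≤ (K : EReal)) →
      ∃ v : ℝ → H, ASD.MemA2 T v ∧
        (∀ᵐ t ∂(volume.restrict (Icc (0 : ℝ) T)), L t (v t) (deriv v t) < ⊤) ∧
        ASD.action T L l v = 0 ∧
        ∀ u : ℝ → H, ASD.MemA2 T u → 0 ≤ ASD.action T L l u) ∧
    -- the boundary Lagrangian that encodes the initial condition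
    (∀ v₀ : H, ∃ v : ℝ → H, ASD.MemA2 T v ∧
      ASD.action T L (ASD.initialBoundary v₀) v = 0 ∧
      (∀ u : ℝ → H, ASD.MemA2 T u → 0 ≤ ASD.action T L (ASD.initialBoundary v₀) u) ∧
      (∀ u : ℝ → H, ASD.MemA2 T u → ASD.action T L (ASD.initialBoundary v₀) u = 0 →
        EqOn u v (Icc (0 : ℝ) T)) ∧
      v 0 = v₀ ∧
      (∀ᵐ t ∂(volume.restrict (Icc (0 : ℝ) T)), L t (v t) (deriv v t) < ⊤) ∧
      ASD.EulerLagrange T L v ∧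
      (∀ᵐ t ∂(volume.restrict (Icc (0 : ℝ) T)),
        (-deriv v t, -v t) ∈ ASD.subdiff₂ (L t) (v t) (deriv v t)) ∧
      IntervalIntegrable (fun s => (L s (v s) (deriv v s)).toReal) volume 0 T ∧
      (∀ t ∈ Icc (0 : ℝ) T,
        ‖v t‖ ^ 2 = ‖v₀‖ ^ 2 - 2 * ∫ s in (0 : ℝ)..t, (L s (v s) (deriv v s)).toReal) ∧
      ((∀ s ∈ Icc (0 : ℝ) T, ∀ t ∈ Icc (0 : ℝ) T, L s = L t) →
        ContDiffOn ℝ 1 v (Icc (0 : ℝ) T) →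
        ∀ t ∈ Icc (0 : ℝ) T,
          ‖derivWithin v (Icc (0 : ℝ) T) t‖ ≤ ‖derivWithin v (Icc (0 : ℝ) T) 0‖)) := by
  have : SecondCountableTopology H := UniformSpace.secondCountable_of_separable H
  refine ⟨fun l hl ⟨ε, hε, K, hK⟩ => ?_, fun v₀ => ?_⟩
  · obtain ⟨v, h1, h2, h3⟩ := ASD.exists_action_eq_zero hT.le hL hbound hl hε hK
    exact ⟨v, h1, h2, h3, fun u hu => ASD.action_nonneg hT.le hL hl hu⟩
  have hl := ASD.isSelfDualBoundary_initialBoundary v₀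
  obtain ⟨v, hv, hdom, hact⟩ := ASD.exists_action_eq_zero hT.le hL hbound hl one_pos
    (fun a ha => ASD.initialBoundary_zero_le v₀ ha)
  obtain ⟨hv0, hLv⟩ := ASD.eq_neg_inner_of_action_eq_zero hT.le hL hv hact
  have hsub : ∀ᵐ t ∂(volume.restrict (Icc (0 : ℝ) T)),
      (-deriv v t, -v t) ∈ ASD.subdiff₂ (L t) (v t) (deriv v t) := by
    filter_upwards [hLv, ae_restrict_mem measurableSet_Icc] with t h1 ht
    exact ASD.mem_subdiff₂_of_eq_neg_inner (hL.lagrangian t ht) (hL.antiselfdual t ht) h1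
  have hreal : ∀ᵐ t ∂(volume.restrict (Icc (0 : ℝ) T)),
      (L t (v t) (deriv v t)).toReal = -inner ℝ (v t) (deriv v t) :=
    hLv.mono fun t ht => by rw [ht, EReal.toReal_coe]
  -- The Euler-Lagrange arc is `ξ = -v`: the joint subgradient `(-v̇, -v)` splits into partial ones.
  refine ⟨v, hv, hact, fun u hu => ASD.action_nonneg hT.le hL hl hu, fun u hu hu0 => ?_, hv0, hdom,
    ⟨fun t => -v t, hv.neg, ?_⟩, hsub, ?_, fun t ht => ?_, fun hconst hC1 t ht => ?_⟩
  · obtain ⟨h0, hLu⟩ := ASD.eq_neg_inner_of_action_eq_zero hT.le hL hu hu0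
    refine ASD.eqOn_of_dissipative hu hv (h0.trans hv0.symm) ?_
    filter_upwards [hLu, hLv, ae_restrict_mem measurableSet_Icc] with t h1 h2 ht
    exact ASD.inner_sub_sub_nonpos (hL.antiselfdual t ht) h1 h2
  · filter_upwards [hsub] with t ht
    rw [deriv.fun_neg]
    exact ASD.subdiff_of_mem_subdiff₂ ht
  · rw [intervalIntegrable_iff_integrableOn_Icc_of_le hT.le]
    exact (hv.integrable_inner_deriv hT.le).neg.congr (hreal.mono fun t ht => ht.symm)
  · have h1 := (hv.mono ht.2).integral_inner_deriv ht.1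
    have h2 : ∫ s in (0 : ℝ)..t, (L s (v s) (deriv v s)).toReal
        = ∫ s in (0 : ℝ)..t, -inner ℝ (v s) (deriv v s) := by
      apply intervalIntegral.integral_congr_ae
      filter_upwards [(ae_restrict_iff' measurableSet_Icc).1 hreal] with s h3 h4
      rw [uIoc_of_le ht.1] at h4
      exact h3 ⟨h4.1.le, h4.2.trans ht.2⟩
    rw [h2, intervalIntegral.integral_neg, h1, hv0]
    ring
  · refine ASD.norm_derivWithin_le_of_translate hT (hC1.differentiableOn one_ne_zero)
      (fun s h hs hh hsh => ASD.norm_translate_sub_le hv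
        (S := {t | t ∈ Icc (0 : ℝ) T ∧
          L t (v t) (deriv v t) = ((-inner ℝ (v t) (deriv v t) : ℝ) : EReal)})
        (by filter_upwards [hLv, ae_restrict_mem measurableSet_Icc] with t h1 h2 using ⟨h2, h1⟩)
        ?_ hs hh hsh) ht
    rintro r ⟨hr, hr'⟩ s ⟨hs, hs'⟩
    -- Autonomy allows extremal points at two different times to be compared under a single
    -- Lagrangian.
    rw [hconst s hs r hr] at hs'
    exact ASD.inner_sub_sub_nonpos (hL.antiselfdual r hr) hr' hs'
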